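/- Let $p=(p_k)_{k\ge 0}$ be a probability distribution on $\{0,1,2,\dots\}$ with $p_0=0$ whose support contains more than one point, and suppose that $\sum_k k\log k\,p_k<\infty$. Put $m=\sum_k k\,p_k$ (which is then finite). Let $\mathbf P'$ be the augmented Galton--Watson measure on the space of isomorphism classes of locally finite rooted trees (with its Borel structure given by the metric $2^{-r}$, $r$ being the maximal radius for which the $r$-balls around the roots are isomorphic): it is the law of the genealogical tree of the branching process in which all individuals reproduce independently, the progenitor (the root) has $k+1$ children with probability $p_k$, and every other individual has $k$ children with probability $p_k$. For a locally finite tree $T$ with root $o$ let $\partial T$ be its boundary (the space of geodesic rays issued from $o$), let $\overline T=T\sqcup\partial T$ be its compactification, with the topology of pointwise convergence of the geodesics issued from $o$ (geodesic segments $[o,x]$ for vertices $x$, geodesic rays for boundary points), and let $\mathrm{N}^n_o$ be the counting measure on the sphere $S^n_o=\{x\in T: d(o,x)=n\}$. Then for $\mathbf P'$-a.e. tree $T_o$ the measures $\mathrm{N}^n_o/m^n$ converge, as $n\to\infty$, in the weak$^*$ topology of finite measures on $\overline T$ to a finite measure $\nu$ which is concentrated on the boundary $\partial T$. Moreover the total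 mass $\|\nu\|$ is $\mathbf P'$-integrable, and its expectation is $$\mathbf E'\|\nu\| = 1+\frac1m .$$ -/

import Mathlib

open Filter Topology MeasureTheory
open scoped NNReal ENNReal

noncomputable section

/-! ### Rooted trees up to isomorphism -/

/-- A locally finite rooted tree. -/
structure LFRootedTree : Type 1 where
  V : Type
  G : SimpleGraph V
  root : V
  isTree : G.IsTree
  locallyFinite : ∀ v, (G.neighborSet v).Finite

namespace LFRootedTree

/-- Two rooted trees are isomorphic if there is a graph isomorphism preserving the roots. -/
def Iso (T T' : LFRootedTree) : Prop :=
  ∃ φ : T.G ≃g T'.G, φ T.root = T'.root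

instance setoid : Setoid LFRootedTree where
  r := Iso
  iseqv :=
    { refl := fun _ => ⟨SimpleGraph.Iso.refl, rfl⟩
      symm := by
        rintro T T' ⟨φ, h⟩
        refine ⟨φ.symm, ?_⟩
        rw [← h]
        exact φ.symm_apply_apply _
      trans := by
        rintro T T' T'' ⟨φ, h⟩ ⟨ψ, h'⟩
        refine ⟨φ.trans ψ, ?_⟩
        change ψ (φ T.root) = T''.root
        rw [h, h'] }

/-- The ball of radius `r` around the root. -/
def ball (T : LFRootedTree) (r : ℕ) : Set T.V := {v | T.G.dist T.root v ≤ r}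

lemma root_mem_ball (T : LFRootedTree) (r : ℕ) : T.root ∈ T.ball r := by
  simp [ball]

/-- The `r`-balls around the roots are isomorphic as rooted graphs. -/
def BallIso (r : ℕ) (T T' : LFRootedTree) : Prop :=
  ∃ φ : T.G.induce (T.ball r) ≃g T'.G.induce (T'.ball r),
    φ ⟨T.root, T.root_mem_ball r⟩ = ⟨T'.root, T'.root_mem_ball r⟩

end LFRootedTree

/-- The space of isomorphism classes of locally finite rooted trees. -/
def TreeSpace : Type 1 := Quotient LFRootedTree.setoid

/-- The isomorphism class of a rooted tree. -/
def LFRootedTree.toClass (T : LFRootedTree) : TreeSpace := Quotient.mk LFRootedTree.setoid T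

/-- The Borel structure of the metric `d(T, T') = 2 ^ (-r)`, where `r` is the maximal radius such
that the `r`-balls around the roots are isomorphic. The sets below are exactly the closed balls
of radius `2 ^ (-r)`; there are only countably many of them, since there are countably many
finite rooted graphs, so the σ-algebra they generate is the Borel one. -/
instance TreeSpace.measurableSpace : MeasurableSpace TreeSpace :=
  MeasurableSpace.generateFrom
    {A | ∃ (T : LFRootedTree) (r : ℕ), A = LFRootedTree.toClass '' {T' | LFRootedTree.BallIso r T T'}}

/-! ### Boundary, compactification and counting measures on spheres -/

namespace LFRootedTree

/-- The boundary of a tree: geodesic rays issued from the root. -/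
def Boundary (T : LFRootedTree) : Type :=
  {γ : ℕ → T.V // γ 0 = T.root ∧ ∀ i k, T.G.dist (γ i) (γ (i + k)) = k}

/-- The compactification of a tree: vertices and boundary points. -/
def Compactification (T : LFRootedTree) : Type := T.V ⊕ T.Boundary

/-- A vertex as a point of the compactification. -/
def ofVertex (T : LFRootedTree) (x : T.V) : T.Compactification := Sum.inl x

/-- The geodesic segment from the root to the vertex `x`. -/
def segment (T : LFRootedTree) (x : T.V) : T.G.Walk T.root x :=
  (T.isTree.existsUnique_path T.root x).choose

/-- The geodesic from the root to a point of the compactification, as a sequence of vertices.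
The geodesic to a vertex `x` stays at `x` after having reached it. -/
def geodesic (T : LFRootedTree) : T.Compactification → ℕ → T.V
  | Sum.inl x => (T.segment x).getVert
  | Sum.inr γ => γ.1

/-- The topology of pointwise convergence of the geodesics issued from the root (the set of
vertices being discrete). -/
instance (T : LFRootedTree) : TopologicalSpace T.Compactification :=
  TopologicalSpace.induced T.geodesic (@Pi.topologicalSpace ℕ (fun _ => T.V) (fun _ => ⊥))

instance (T : LFRootedTree) : MeasurableSpace T.Compactification := borel _

instance (T : LFRootedTree) : BorelSpace T.Compactification := ⟨rfl⟩

/-- The sphere of radius `n` around the root. -/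
def sphere (T : LFRootedTree) (n : ℕ) : Set T.V := {v | T.G.dist T.root v = n}

lemma sphere_finite (T : LFRootedTree) (n : ℕ) : (T.sphere n).Finite := by
  induction n with
  | zero =>
    refine (Set.finite_singleton T.root).subset fun v hv => ?_
    have : T.root = v := (T.isTree.connected.dist_eq_zero_iff).1 hv
    simp [this]
  | succ n ih =>
    refine (ih.biUnion fun v _ => T.locallyFinite v).subset fun v hv => ?_
    obtain ⟨w, hw⟩ := (T.isTree.connected v T.root).exists_walk_length_eq_dist
    have hv' : T.G.dist v T.root = n + 1 := by
      rw [SimpleGraph.dist_comm]; exact hv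
    cases w with
    | nil => simp at hv'
    | @cons _ u _ h q =>
      have hq : q.length = n := by
        rw [hv', SimpleGraph.Walk.length_cons] at hw
        omega
      have h1 : T.G.dist T.root u ≤ n := by
        rw [SimpleGraph.dist_comm, ← hq]
        exact SimpleGraph.dist_le q
      have h2 : T.G.dist T.root v ≤ T.G.dist T.root u + T.G.dist u v :=
        T.isTree.connected.dist_triangle
      have h3 : T.G.dist u v = 1 := SimpleGraph.dist_eq_one_iff_adj.2 h.symm
      have h4 : T.G.dist T.root v = n + 1 := hv
      refine Set.mem_biUnion (x := u) ?_ h.symm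
      change T.G.dist T.root u = n
      omega

/-- The counting measure on the sphere of radius `n`, as a measure on the compactification. -/
def sphereMeasure (T : LFRootedTree) (n : ℕ) : FiniteMeasure T.Compactification :=
  ⟨∑ x ∈ (T.sphere_finite n).toFinset, Measure.dirac (T.ofVertex x), inferInstance⟩

end LFRootedTree

/-! ### Augmented Galton–Watson trees -/

namespace GaltonWatson

/-- Individuals are labelled by words in the Ulam–Harris way: the children of the individual `v`
are `i :: v` with `i < k v`, where `k v` is the number of children of `v`; the progenitor
is `[]`. The predicate says that the label `v` belongs to an individual that is born. -/
def IsBorn (k : List ℕ → ℕ) : List ℕ → Prop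
  | [] => True
  | i :: v => i < k v ∧ IsBorn k v

/-- The parent-child graph of the individuals that are born. -/
def genealogy (k : List ℕ → ℕ) : SimpleGraph {v : List ℕ // IsBorn k v} where
  Adj u v := (∃ i, v.1 = i :: u.1) ∨ (∃ i, u.1 = i :: v.1)
  symm := ⟨fun _ _ h => h.symm⟩
  loopless := ⟨fun u h => by
    rcases h with ⟨i, h⟩ | ⟨i, h⟩ <;> simpa using congrArg List.length h⟩

lemma genealogy_connected (k : List ℕ → ℕ) : (genealogy k).Connected := by
  have key : ∀ (v : List ℕ) (hv : IsBorn k v),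
      (genealogy k).Reachable ⟨[], trivial⟩ ⟨v, hv⟩ := by
    intro v
    induction v with
    | nil => intro _; rfl
    | cons i v ih =>
      intro hv
      exact (ih hv.2).trans (SimpleGraph.Adj.reachable (Or.inl ⟨i, rfl⟩))
  exact { preconnected := fun u v => (key u.1 u.2).symm.trans (key v.1 v.2)
          nonempty := ⟨⟨[], trivial⟩⟩ }

lemma genealogy_isBridge (k : List ℕ → ℕ) (u v : {v : List ℕ // IsBorn k v}) (i : ℕ)
    (h : v.1 = i :: u.1) : (genealogy k).IsBridge s(u, v) := by
  rw [SimpleGraph.isBridge_iff]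
  rintro ⟨w⟩
  have key : ∀ (a b : {v : List ℕ // IsBorn k v})
      (_ : ((genealogy k).deleteEdges {s(u, v)}).Walk a b), v.1 <:+ b.1 → v.1 <:+ a.1 := by
    intro a b q
    induction q with
    | nil => exact id
    | @cons a c b hac q ih =>
      intro hb
      have hc := ih hb
      rw [SimpleGraph.deleteEdges_adj] at hac
      obtain ⟨hadj, hne⟩ := hac
      rcases hadj with ⟨j, hj⟩ | ⟨j, hj⟩
      · rw [hj, List.suffix_cons_iff] at hc
        rcases hc with hc | hc
        · exfalso
          apply hne
          have hcv : c = v := Subtype.ext (by rw [hj, hc])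
          have hau : a = u := by
            apply Subtype.ext
            rw [h] at hc
            exact (List.cons.inj hc).2.symm
          rw [hcv, hau]
          rfl
        · exact hc
      · rw [hj]
        exact hc.trans (List.suffix_cons _ _)
  have := (key u v w List.suffix_rfl).length_le
  rw [h] at this
  simp at this

lemma genealogy_isTree (k : List ℕ → ℕ) : (genealogy k).IsTree := by
  refine ⟨genealogy_connected k, ?_⟩
  rw [SimpleGraph.isAcyclic_iff_forall_adj_isBridge]
  rintro u v (⟨i, h⟩ | ⟨i, h⟩)
  · exact genealogy_isBridge k u v i h
  · rw [Sym2.eq_swap]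
    exact genealogy_isBridge k v u i h

lemma genealogy_locallyFinite (k : List ℕ → ℕ) (v : {v : List ℕ // IsBorn k v}) :
    ((genealogy k).neighborSet v).Finite := by
  have hfin : ({w | w = v.1.tail} ∪ (fun i => i :: v.1) '' Set.Iio (k v.1)).Finite :=
    (Set.finite_singleton _).union ((Set.finite_Iio _).image _)
  refine (hfin.preimage Subtype.val_injective.injOn).subset ?_
  rintro w (⟨i, h⟩ | ⟨i, h⟩)
  · right
    have := w.2
    rw [h] at this
    exact ⟨i, this.1, h.symm⟩
  · left
    simp [h]

/-- The rooted tree of a family of numbers of children. -/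
def tree (k : List ℕ → ℕ) : LFRootedTree where
  V := {v : List ℕ // IsBorn k v}
  G := genealogy k
  root := ⟨[], trivial⟩
  isTree := genealogy_isTree k
  locallyFinite := genealogy_locallyFinite k

/-- The joint law of the numbers of children in the augmented process: they are independent, with
distribution `p`, except that the progenitor has `j + 1` children with probability `p j`. -/
def augmentedOffspring (p : PMF ℕ) : Measure (List ℕ → ℕ) :=
  Measure.infinitePi fun v => (if v = [] then p.map Nat.succ else p).toMeasure

/-- The augmented Galton–Watson measure on the space of rooted trees. -/
def augmentedMeasure (p : PMF ℕ) : Measure TreeSpace :=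
  (augmentedOffspring p).map fun k => (tree k).toClass

/-- The mean of the offspring distribution. -/
def mean (p : PMF ℕ) : ℝ≥0 := ∑' j : ℕ, (j : ℝ≥0) * (p j).toNNReal

end GaltonWatson

end

/-! Write $Z_n(x)$ for the number of descendants of $x$ after $n$ generations. If $Z_n(x)/m^n$
converges for every vertex $x$, the normalized sphere measures converge weak*: on the compact space
$\overline T$ a continuous function is uniformly close to a function of the $r$-th vertex of the
geodesic, and the integral of the latter is a finite combination of the numbers $Z_{n-r}(x)/m^n$.
Vertices are isolated points which the spheres eventually leave, so the limit does not charge them;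
its mass is $\lim Z_n(o)/m^n$ (`exists_tendsto_sphereMeasure`).

In the Ulam–Harris model, $Z_n(v)/m^n$ is a nonnegative martingale for each label $v$ other than the
root, so all these sequences converge a.s.; the root is handled by summing over its children. Hence
$\|\nu\| = m^{-1}\sum_{i<k(o)} W_i$, where the $W_i$ are the limits at the children, and
independence gives $\mathbf E'\|\nu\| = \frac{m+1}{m}\,\mathbf E W$.

It remains to see that $\mathbf E W=1$ (Kesten–Stigum, `lintegral_normalizedLimit`). Fatou gives
$\le 1$. For the converse, let $f$ be the generating function and $d(u)=1-f(1-u)$. Then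
$mu(1-e(u))\le d(u)\le mu$, with an error $e$ that is summable along $m^{-n}$ by the $L\log L$
condition. Iterating $d$ yields $\mathbf E e^{-sW}\le 1-s(1-s)(1-T_r)$ for $s=m^{-r}$, where
$T_r\to0$ is a tail of that series. Combined with $1\le e^{-sW}+sW$ this gives $\mathbf E
W\ge(1-s)(1-T_r)\to1$.

The passage to isomorphism classes rests on the countability of finite rooted graphs: any property
of a ball of fixed radius is measurable. -/

namespace LFRootedTree

/-! ### Geodesics, generations and descendants in a rooted tree -/

variable (T : LFRootedTree)

/-- The distance of a vertex from the root. -/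
noncomputable def level (x : T.V) : ℕ := T.G.dist T.root x

/-- The `i`-th vertex on the geodesic from the root to `x`, constant after `x`. -/
noncomputable def anc (x : T.V) (i : ℕ) : T.V := (T.segment x).getVert i

/-- The neighbours of `x` that are farther from the root. -/
noncomputable def children (x : T.V) : Finset T.V :=
  ((T.locallyFinite x).subset
    (show {y | T.G.Adj x y ∧ T.level y = T.level x + 1} ⊆ _ from fun _ h => h.1)).toFinset

/-- The number of descendants of `x` in the `n`-th generation after `x`. -/
noncomputable def descendantCount : ℕ → T.V → ℕ
  | 0, _ => 1
  | n + 1, x => ∑ y ∈ T.children x, descendantCount n y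

/-- The sphere around the root as a finite set. -/
noncomputable def sphereFinset (n : ℕ) : Finset T.V := (T.sphere_finite n).toFinset

@[simp] lemma mem_sphereFinset {n : ℕ} {x : T.V} : x ∈ T.sphereFinset n ↔ T.level x = n := by
  simp [sphereFinset, sphere, level]

@[simp] lemma mem_children {x y : T.V} :
    y ∈ T.children x ↔ T.G.Adj x y ∧ T.level y = T.level x + 1 := by
  simp [children]

@[simp] lemma level_root : T.level T.root = 0 := by simp [level]

lemma level_eq_zero {x : T.V} : T.level x = 0 ↔ x = T.root := by
  rw [level, T.isTree.connected.dist_eq_zero_iff, eq_comm]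

lemma segment_isPath (x : T.V) : (T.segment x).IsPath :=
  (T.isTree.existsUnique_path T.root x).choose_spec.1

lemma eq_segment {x : T.V} (w : T.G.Walk T.root x) (hw : w.IsPath) : w = T.segment x :=
  (T.isTree.existsUnique_path T.root x).choose_spec.2 w hw

lemma length_segment (x : T.V) : (T.segment x).length = T.level x := by
  obtain ⟨w, hw, hl⟩ := T.isTree.connected.exists_path_of_dist T.root x
  rw [← T.eq_segment w hw, hl, level]

lemma anc_of_level_le {x : T.V} {i : ℕ} (h : T.level x ≤ i) : T.anc x i = x :=
  SimpleGraph.Walk.getVert_of_length_le _ (by rwa [length_segment])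

@[simp] lemma anc_level (x : T.V) : T.anc x (T.level x) = x := T.anc_of_level_le le_rfl

@[simp] lemma anc_zero (x : T.V) : T.anc x 0 = T.root := SimpleGraph.Walk.getVert_zero _

/-- An initial piece of a path is a path, hence by uniqueness is the segment to its endpoint. -/
lemma anc_anc (x : T.V) (i j : ℕ) : T.anc (T.anc x j) i = T.anc x (min i j) := by
  have h := T.eq_segment ((T.segment x).take j) ((T.segment_isPath x).take j)
  rw [anc, anc, ← h, SimpleGraph.Walk.take_getVert, min_comm]
  rfl

lemma level_anc (x : T.V) (i : ℕ) : T.level (T.anc x i) = min i (T.level x) := by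
  have h := T.eq_segment ((T.segment x).take i) ((T.segment_isPath x).take i)
  have := T.length_segment (T.anc x i)
  rw [← this]
  change (T.segment ((T.segment x).getVert i)).length = _
  rw [← h, SimpleGraph.Walk.take_length, length_segment]

lemma adj_anc_succ {x : T.V} {i : ℕ} (h : i < T.level x) :
    T.G.Adj (T.anc x i) (T.anc x (i + 1)) :=
  (T.segment x).adj_getVert_succ (by rwa [length_segment])

lemma anc_mem_children {x : T.V} {i : ℕ} (h : i < T.level x) :
    T.anc x (i + 1) ∈ T.children (T.anc x i) := by
  rw [mem_children]
  refine ⟨T.adj_anc_succ h, ?_⟩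
  rw [level_anc, level_anc]
  omega

lemma anc_child {x y : T.V} (h : y ∈ T.children x) {i : ℕ} (hi : i ≤ T.level x) :
    T.anc y i = T.anc x i := by
  rw [mem_children] at h
  have hc : (T.segment x).concat h.1 = T.segment y := by
    apply T.eq_segment
    apply SimpleGraph.Walk.isPath_of_length_eq_dist
    rw [SimpleGraph.Walk.length_concat, length_segment]
    exact h.2.symm
  rw [anc, ← hc, SimpleGraph.Walk.concat_eq_append, SimpleGraph.Walk.getVert_append, length_segment]
  split_ifs with hlt
  · rfl
  · have : i = T.level x := by omega
    subst this
    simp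

lemma parent_eq {x y : T.V} (h : y ∈ T.children x) : T.anc y (T.level x) = x := by
  rw [T.anc_child h le_rfl, anc_level]

/-- Each vertex of the next sphere has exactly one parent, so that sphere is the disjoint union of
the sets of children. -/
lemma sum_sphereFinset_succ {M : Type*} [AddCommMonoid M] (n : ℕ) (F : T.V → M) :
    ∑ y ∈ T.sphereFinset (n + 1), F y = ∑ x ∈ T.sphereFinset n, ∑ y ∈ T.children x, F y := by
  classical
  rw [← Finset.sum_biUnion]
  · refine Finset.sum_congr ?_ fun _ _ => rfl
    ext y
    simp only [mem_sphereFinset, Finset.mem_biUnion]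
    constructor
    · intro h
      refine ⟨T.anc y n, ?_, ?_⟩
      · rw [level_anc]; omega
      · have := T.anc_mem_children (x := y) (i := n) (by omega)
        rwa [T.anc_of_level_le h.le] at this
    · rintro ⟨x, hx, hy⟩
      rw [mem_children] at hy
      omega
  · intro x hx x' hx' hne
    rw [Function.onFun, Finset.disjoint_left]
    intro y hy hy'
    apply hne
    rw [← T.parent_eq hy, ← T.parent_eq hy']
    simp only [mem_sphereFinset, Finset.mem_coe] at hx hx'
    rw [hx, hx']

/-- Summing a function of the `r`-th ancestor over the sphere of radius `r + n`. -/
lemma sum_sphereFinset_add (n : ℕ) : ∀ (r : ℕ) (h : T.V → ℝ),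
    ∑ y ∈ T.sphereFinset (r + n), h (T.anc y r)
      = ∑ x ∈ T.sphereFinset r, h x * T.descendantCount n x := by
  induction n with
  | zero =>
    intro r h
    refine Finset.sum_congr rfl fun y hy => ?_
    rw [mem_sphereFinset] at hy
    rw [T.anc_of_level_le hy.le]
    simp [descendantCount]
  | succ n ih =>
    intro r h
    -- `descendantCount` recurses through the children, so the induction hypothesis is used one
    -- level lower, for a function that looks back at the parent.
    have h1 := ih (r + 1) (fun z => h (T.anc z r))
    simp only [anc_anc, Nat.min_eq_left (Nat.le_succ r)] at h1
    rw [show r + (n + 1) = r + 1 + n by ring, h1, sum_sphereFinset_succ]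
    refine Finset.sum_congr rfl fun x hx => ?_
    rw [descendantCount, Nat.cast_sum, Finset.mul_sum]
    refine Finset.sum_congr rfl fun z hz => ?_
    rw [mem_sphereFinset] at hx
    rw [← hx, T.parent_eq hz]

lemma sphereFinset_zero : T.sphereFinset 0 = {T.root} := by
  ext x
  simp [level_eq_zero]

lemma card_sphereFinset (n : ℕ) : (T.sphereFinset n).card = T.descendantCount n T.root := by
  have h := T.sum_sphereFinset_add n 0 (fun _ => 1)
  rw [sphereFinset_zero] at h
  simp only [zero_add, Finset.sum_const, nsmul_eq_mul, mul_one, Finset.sum_singleton, one_mul] at h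
  exact_mod_cast h

lemma ball_finite (n : ℕ) : (T.ball n).Finite := by
  refine ((Set.finite_Iic n).biUnion fun i _ => T.sphere_finite i).subset fun v hv => ?_
  exact Set.mem_biUnion (show T.G.dist T.root v ∈ Set.Iic n from hv) rfl

/-! ### The compactification -/

@[simp] lemma geodesic_ofVertex (x : T.V) : T.geodesic (T.ofVertex x) = T.anc x := rfl

lemma level_boundary (γ : T.Boundary) (j : ℕ) : T.level (γ.1 j) = j := by
  have := γ.2.2 0 j
  rwa [γ.2.1, zero_add] at this

lemma anc_geodesic (ξ : T.Compactification) (i j : ℕ) :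
    T.anc (T.geodesic ξ j) i = T.geodesic ξ (min i j) := by
  rcases ξ with x | γ
  · exact T.anc_anc x i j
  · change T.anc (γ.1 j) i = γ.1 (min i j)
    induction j with
    | zero => simp [γ.2.1, T.anc_of_level_le]
    | succ j ih =>
      rcases le_or_gt i j with h | h
      · rw [min_eq_left (by omega)]
        rw [min_eq_left h] at ih
        rw [← ih]
        refine T.anc_child ?_ (by rwa [level_boundary])
        rw [mem_children, level_boundary, level_boundary]
        exact ⟨SimpleGraph.dist_eq_one_iff_adj.1 (γ.2.2 j 1), rfl⟩
      · rw [min_eq_right (by omega), T.anc_of_level_le]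
        rw [level_boundary]
        omega

lemma level_geodesic_le (ξ : T.Compactification) (n : ℕ) : T.level (T.geodesic ξ n) ≤ n := by
  rcases ξ with x | γ
  · change T.level (T.anc x n) ≤ n
    rw [level_anc]
    exact min_le_left _ _
  · exact (T.level_boundary γ n).le

/-- A coherent sequence either reaches level `n` at every time `n`, and is a ray, or falls behind at
some time, and is constant from then on. This exhibits the compactification as a subset of a product
cut out by closed conditions. -/
lemma range_geodesic :
    Set.range T.geodesic = {g | ∀ i j, T.anc (g j) i = g (min i j)} := by
  ext g
  constructor
  · rintro ⟨ξ, rfl⟩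
    exact T.anc_geodesic ξ
  · intro hg
    have hl : ∀ i j, i ≤ j → T.level (g i) = min i (T.level (g j)) := by
      intro i j hij
      rw [← T.level_anc (g j) i, hg i j, min_eq_left hij]
    by_cases hn : ∀ n, T.level (g n) = n
    · have hadj : ∀ i, T.G.Adj (g i) (g (i + 1)) := by
        intro i
        have := T.adj_anc_succ (x := g (i + 1)) (i := i) (by rw [hn]; omega)
        rwa [hg, hg, min_self, min_eq_left (Nat.le_succ i)] at this
      refine ⟨Sum.inr ⟨g, T.level_eq_zero.1 (hn 0), fun i k => le_antisymm ?_ ?_⟩, rfl⟩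
      · induction k with
        | zero => simp
        | succ k ih =>
          refine (T.isTree.connected.dist_triangle (v := g (i + k))).trans ?_
          have : T.G.dist (g (i + k)) (g (i + (k + 1))) = 1 :=
            SimpleGraph.dist_eq_one_iff_adj.2 (hadj (i + k))
          omega
      · have h1 := T.isTree.connected.dist_triangle (u := T.root) (v := g i) (w := g (i + k))
        have h2 : T.G.dist T.root (g i) = i := hn i
        have h3 : T.G.dist T.root (g (i + k)) = i + k := hn (i + k)
        omega
    · push Not at hn
      obtain ⟨n, hn⟩ := hn
      have hlt : T.level (g n) < n := by
        have := hl n n le_rfl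
        omega
      refine ⟨T.ofVertex (g n), funext fun j => ?_⟩
      rw [geodesic_ofVertex, hg]
      rcases le_total j n with h | h
      · rw [min_eq_left h]
      · rw [min_eq_right h]
        -- Since `g n` has level below `n`, so does `g j`; hence `g j` is its own `n`-th ancestor.
        have h1 := hl n j h
        have h2 := hg n j
        rw [min_eq_left h, T.anc_of_level_le (by omega)] at h2
        exact h2.symm

lemma geodesic_injective : Function.Injective T.geodesic := by
  have key : ∀ (x : T.V) (γ : T.Boundary), T.anc x ≠ γ.1 := by
    intro x γ h
    have h1 := T.level_boundary γ (T.level x + 1)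
    rw [← h, level_anc] at h1
    omega
  rintro (x | γ) (y | δ) h
  · change T.anc x = T.anc y at h
    have h1 : T.anc x (max (T.level x) (T.level y)) = T.anc y (max (T.level x) (T.level y)) := by
      rw [h]
    rw [T.anc_of_level_le (le_max_left _ _), T.anc_of_level_le (le_max_right _ _)] at h1
    rw [h1]
  · exact (key x δ h).elim
  · exact (key y γ h.symm).elim
  · exact congrArg Sum.inr (Subtype.ext h)

lemma isClopen_cylinder (n : ℕ) (s : Set T.V) :
    IsClopen {ξ : T.Compactification | T.geodesic ξ n ∈ s} := by
  let : TopologicalSpace T.V := ⊥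
  have : DiscreteTopology T.V := ⟨rfl⟩
  have hc : Continuous T.geodesic := continuous_induced_dom
  have : Continuous fun ξ => T.geodesic ξ n := (continuous_apply n).comp hc
  exact (isClopen_discrete s).preimage this

instance : T2Space T.Compactification := by
  let : TopologicalSpace T.V := ⊥
  have : DiscreteTopology T.V := ⟨rfl⟩
  have hc : Continuous T.geodesic := continuous_induced_dom
  exact T2Space.of_injective_continuous T.geodesic_injective hc

/-- By Tychonoff: the geodesics form a closed subset of the product of the finite balls. -/
instance : CompactSpace T.Compactification := by
  let : TopologicalSpace T.V := ⊥
  have : DiscreteTopology T.V := ⟨rfl⟩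
  have hi : IsInducing T.geodesic := ⟨rfl⟩
  constructor
  rw [hi.isCompact_iff, Set.image_univ]
  have hK : IsCompact (Set.pi Set.univ fun n => T.ball n) :=
    isCompact_univ_pi fun n => (T.ball_finite n).isCompact
  refine hK.of_isClosed_subset ?_ ?_
  · rw [range_geodesic]
    have : {g : ℕ → T.V | ∀ i j, T.anc (g j) i = g (min i j)}
        = ⋂ i, ⋂ j, {g | T.anc (g j) i = g (min i j)} := by
      ext g; simp
    rw [this]
    refine isClosed_iInter fun i => isClosed_iInter fun j => isClosed_eq ?_ (continuous_apply _)
    exact (continuous_of_discreteTopology (f := fun x => T.anc x i)).comp (continuous_apply j)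
  · rintro _ ⟨ξ, rfl⟩ n _
    exact T.level_geodesic_le ξ n

/-- A continuous function on the compactification is nearly a function of the `r`-th vertex of
the geodesic. -/
lemma exists_cylinder_approx {f : T.Compactification → ℝ} (hf : Continuous f) {ε : ℝ}
    (hε : 0 < ε) : ∃ r, ∀ ξ η, T.geodesic ξ r = T.geodesic η r → |f ξ - f η| ≤ ε := by
  let : TopologicalSpace T.V := ⊥
  have : DiscreteTopology T.V := ⟨rfl⟩
  have hi : IsInducing T.geodesic := ⟨rfl⟩
  have mono : ∀ {ξ η : T.Compactification} {i j : ℕ}, i ≤ j → T.geodesic ξ j = T.geodesic η j →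
      T.geodesic ξ i = T.geodesic η i := by
    intro ξ η i j hij h
    rw [← min_eq_left hij, ← anc_geodesic, ← anc_geodesic, h]
  have hloc : ∀ ξ, ∃ r, ∀ η, T.geodesic η r = T.geodesic ξ r → |f η - f ξ| < ε / 2 := by
    intro ξ
    have hU : ∀ᶠ η in 𝓝 ξ, |f η - f ξ| < ε / 2 := by
      have := Metric.tendsto_nhds.1 (hf.tendsto ξ) (ε / 2) (by positivity)
      simpa [Real.dist_eq] using this
    rw [hi.nhds_eq_comap, Filter.eventually_iff, Filter.mem_comap] at hU
    obtain ⟨V, hV, hVU⟩ := hU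
    rw [nhds_pi, Filter.mem_pi] at hV
    obtain ⟨I, hI, t, ht, hIt⟩ := hV
    obtain ⟨r, hr⟩ := hI.bddAbove
    refine ⟨r, fun η hη => hVU (hIt fun i hi => ?_)⟩
    rw [mono (hr hi) hη]
    exact mem_of_mem_nhds (ht i)
  choose r hr using hloc
  obtain ⟨s, hs⟩ := isCompact_univ.elim_nhds_subcover
    (fun ξ => {η | T.geodesic η (r ξ) = T.geodesic ξ (r ξ)})
    (fun ξ _ => (T.isClopen_cylinder (r ξ) {T.geodesic ξ (r ξ)}).isOpen.mem_nhds rfl)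
  -- Points that agree at the largest radius of the finite subcover lie in a common cylinder, so
  -- both values are within `ε / 2` of the value at its centre.
  refine ⟨s.sup r, fun ξ η h => ?_⟩
  obtain ⟨ζ, hζ, hξ⟩ := Set.mem_iUnion₂.1 (hs.2 (Set.mem_univ ξ))
  have h1 := hr ζ ξ hξ
  have h2 := hr ζ η ((mono (Finset.le_sup hζ) h).symm.trans hξ)
  rw [abs_lt] at h1 h2
  rw [abs_le]
  constructor <;> linarith [h1.1, h1.2, h2.1, h2.2]

end LFRootedTree

/-! ### Weak convergence of the normalized sphere measures -/

namespace LFRootedTree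

variable (T : LFRootedTree)

lemma integral_sphereMeasure (c : ℝ≥0) (n : ℕ) (f : T.Compactification → ℝ)
    (hf : StronglyMeasurable f) :
    ∫ ξ, f ξ ∂((c • T.sphereMeasure n : FiniteMeasure T.Compactification) :
        Measure T.Compactification)
      = c * ∑ x ∈ T.sphereFinset n, f (T.ofVertex x) := by
  have h1 : ((c • T.sphereMeasure n : FiniteMeasure T.Compactification) :
      Measure T.Compactification)
      = c • ∑ x ∈ T.sphereFinset n, Measure.dirac (T.ofVertex x) := rfl
  rw [h1, integral_smul_nnreal_measure, integral_finsetSum_measure]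
  · simp only [integral_dirac' _ _ hf]
    rfl
  · intro x _
    exact integrable_dirac' hf (by simp)

lemma tendsto_descendantCount_sub {m : ℝ≥0} (hm : 1 < m) {w : ℝ} {x : T.V} (r : ℕ)
    (h : Tendsto (fun n => (T.descendantCount n x : ℝ) / (m : ℝ) ^ n) atTop (𝓝 w)) :
    Tendsto (fun n => (T.descendantCount (n - r) x : ℝ) / (m : ℝ) ^ n) atTop
      (𝓝 (w / (m : ℝ) ^ r)) := by
  have hm0 : (m : ℝ) ≠ 0 := by
    have : (0 : ℝ≥0) < m := lt_trans one_pos hm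
    exact_mod_cast this.ne'
  have h1 := (h.comp (tendsto_sub_atTop_nat r)).div_const ((m : ℝ) ^ r)
  refine h1.congr' ?_
  filter_upwards [eventually_ge_atTop r] with n hn
  simp only [Function.comp]
  rw [div_div, ← pow_add, Nat.sub_add_cancel hn]

/-- Integrals of continuous functions against the normalized sphere measures converge. -/
lemma exists_tendsto_integral {m : ℝ≥0} (hm : 1 < m)
    (h : ∀ x, ∃ w : ℝ, Tendsto (fun n => (T.descendantCount n x : ℝ) / (m : ℝ) ^ n) atTop (𝓝 w))
    {f : T.Compactification → ℝ} (hf : Continuous f) :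
    ∃ l, Tendsto (fun n => ((m ^ n)⁻¹ : ℝ≥0) * ∑ x ∈ T.sphereFinset n, f (T.ofVertex x)) atTop
      (𝓝 l) := by
  choose w hw using h
  refine cauchySeq_tendsto_of_complete (Metric.cauchySeq_iff'.2 fun ε hε => ?_)
  set a : ℕ → ℝ := fun n => ((m ^ n)⁻¹ : ℝ≥0) * ∑ x ∈ T.sphereFinset n, f (T.ofVertex x) with ha
  obtain ⟨C, hC⟩ := (hw T.root).bddAbove_range
  have hC' : ∀ n, (T.descendantCount n T.root : ℝ) / (m : ℝ) ^ n ≤ C := fun n => hC ⟨n, rfl⟩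
  have hC0 : 0 ≤ C := le_trans (by positivity) (hC' 0)
  -- This makes `δ * C ≤ ε / 4`; the final estimate adds two approximation errors and two errors for
  -- `b`, each at most `ε / 4`.
  set δ := ε / (4 * (C + 1)) with hδ
  have hδ0 : 0 < δ := by positivity
  obtain ⟨r, hr⟩ := T.exists_cylinder_approx hf hδ0
  -- For `r ≤ n` this is the normalized sum of `f (T.ofVertex (T.anc y r))` over the `n`-sphere,
  -- regrouped by the ancestor at level `r`.
  set b : ℕ → ℝ := fun n =>
    ∑ x ∈ T.sphereFinset r, f (T.ofVertex x) * ((T.descendantCount (n - r) x : ℝ) / (m : ℝ) ^ n)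
    with hb
  have hbl : Tendsto b atTop
      (𝓝 (∑ x ∈ T.sphereFinset r, f (T.ofVertex x) * (w x / (m : ℝ) ^ r))) :=
    tendsto_finsetSum _ fun x _ => (T.tendsto_descendantCount_sub hm r (hw x)).const_mul _
  have hab : ∀ n, r ≤ n → |a n - b n| ≤ δ * C := by
    intro n hn
    have h1 := T.sum_sphereFinset_add (n - r) r (fun x => f (T.ofVertex x))
    rw [Nat.add_sub_cancel' hn] at h1
    have h2 : b n = ((m ^ n)⁻¹ : ℝ≥0) *
        ∑ y ∈ T.sphereFinset n, f (T.ofVertex (T.anc y r)) := by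
      rw [h1, hb, Finset.mul_sum]
      refine Finset.sum_congr rfl fun x _ => ?_
      push_cast
      ring
    rw [h2, ha, ← mul_sub, ← Finset.sum_sub_distrib, abs_mul, NNReal.abs_eq]
    calc _ ≤ (((m ^ n)⁻¹ : ℝ≥0) : ℝ) * ∑ y ∈ T.sphereFinset n, δ := by
          gcongr
          refine (Finset.abs_sum_le_sum_abs _ _).trans (Finset.sum_le_sum fun y _ => ?_)
          apply hr
          simp only [geodesic_ofVertex, anc_anc, min_self]
      _ = δ * ((T.descendantCount n T.root : ℝ) / (m : ℝ) ^ n) := by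
          rw [Finset.sum_const, card_sphereFinset, nsmul_eq_mul]
          push_cast
          ring
      _ ≤ δ * C := by gcongr; exact hC' n
  have hδC : δ * C ≤ ε / 4 := by
    rw [hδ, div_mul_eq_mul_div, div_le_div_iff₀ (by positivity) (by positivity)]
    nlinarith
  obtain ⟨M, hM⟩ := Metric.cauchySeq_iff'.1 hbl.cauchySeq (ε / 4) (by positivity)
  refine ⟨max M r, fun n hn => ?_⟩
  have e1 := hab n ((le_max_right _ _).trans hn)
  have e2 := hab (max M r) (le_max_right _ _)
  have e3 := hM n ((le_max_left _ _).trans hn)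
  have e4 := hM (max M r) (le_max_left _ _)
  rw [Real.dist_eq, abs_lt] at e3 e4
  rw [abs_le] at e1 e2
  rw [Real.dist_eq, abs_lt]
  constructor <;> linarith [e1.1, e1.2, e2.1, e2.2, e3.1, e3.2, e4.1, e4.2]

lemma mass_smul_sphereMeasure (c : ℝ≥0) (n : ℕ) :
    (c • T.sphereMeasure n).mass = c * T.descendantCount n T.root := by
  have h2 : (T.sphereMeasure n).mass = T.descendantCount n T.root := by
    have h1 : (T.sphereMeasure n : Measure T.Compactification)
        = ∑ x ∈ T.sphereFinset n, Measure.dirac (T.ofVertex x) := rfl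
    rw [← ENNReal.coe_inj, FiniteMeasure.ennreal_mass, h1, Measure.finsetSum_apply]
    simp [card_sphereFinset]
  rw [← h2]
  simp [FiniteMeasure.mass]

instance : Countable T.V := by
  rw [← Set.countable_univ_iff]
  refine (Set.countable_iUnion fun n => (T.sphere_finite n).countable).mono fun x _ => ?_
  exact Set.mem_iUnion.2 ⟨T.G.dist T.root x, rfl⟩

/-- If the normalized numbers of descendants of all vertices converge, then the normalized sphere
measures converge weakly to a measure that is concentrated on the boundary. -/
theorem exists_tendsto_sphereMeasure {m : ℝ≥0} (hm : 1 < m)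
    (h : ∀ x, ∃ w : ℝ, Tendsto (fun n => (T.descendantCount n x : ℝ) / (m : ℝ) ^ n) atTop (𝓝 w)) :
    ∃ ν : FiniteMeasure T.Compactification,
      Tendsto (fun n : ℕ => (m ^ n)⁻¹ • T.sphereMeasure n) atTop (𝓝 ν) ∧
      (ν : Measure T.Compactification) (Set.range T.ofVertex) = 0 ∧
      Tendsto (fun n => (T.descendantCount n T.root : ℝ) / (m : ℝ) ^ n) atTop (𝓝 (ν.mass : ℝ)) := by
  have hm0 : 0 < m := lt_trans one_pos hm
  set μ : ℕ → FiniteMeasure T.Compactification := fun n => (m ^ n)⁻¹ • T.sphereMeasure n with hμ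
  have hmass : ∀ n, ((μ n).mass : ℝ) = (T.descendantCount n T.root : ℝ) / (m : ℝ) ^ n := by
    intro n
    rw [hμ, mass_smul_sphereMeasure]
    push_cast
    ring
  obtain ⟨w, hw⟩ := h T.root
  obtain ⟨C, hC⟩ := hw.bddAbove_range
  have hC' : ∀ n, (μ n).mass ≤ C.toNNReal := by
    intro n
    rw [← NNReal.coe_le_coe, hmass]
    exact (hC ⟨n, rfl⟩ : _ ≤ C).trans (Real.le_coe_toNNReal C)
  have hint : ∀ f : BoundedContinuousFunction T.Compactification ℝ,
      ∃ l, Tendsto (fun n => ∫ ξ, f ξ ∂(μ n : Measure T.Compactification)) atTop (𝓝 l) := by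
    intro f
    obtain ⟨l, hl⟩ := T.exists_tendsto_integral hm h f.continuous
    refine ⟨l, hl.congr fun n => ?_⟩
    rw [hμ, integral_sphereMeasure]
    exact f.continuous.measurable.stronglyMeasurable
  -- Measures of bounded mass on a compact space form a weak* compact set. As all integrals
  -- converge, a cluster point is the limit.
  obtain ⟨ν, -, hν⟩ := (isCompact_setOfPred_finiteMeasure_le_of_compactSpace T.Compactification
    C.toNNReal).exists_mapClusterPt (f := atTop) (u := μ)
    (tendsto_principal.2 (Eventually.of_forall hC'))
  have hlim : Tendsto μ atTop (𝓝 ν) := by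
    rw [FiniteMeasure.tendsto_iff_forall_integral_tendsto]
    intro f
    obtain ⟨l, hl⟩ := hint f
    have hc : Tendsto (fun ρ : FiniteMeasure T.Compactification => ∫ ξ, f ξ ∂(ρ : Measure _))
        (𝓝 ν) (𝓝 (∫ ξ, f ξ ∂(ν : Measure _))) :=
      FiniteMeasure.tendsto_iff_forall_integral_tendsto.1 tendsto_id f
    have h1 : MapClusterPt (∫ ξ, f ξ ∂(ν : Measure _)) atTop
        (fun n => ∫ ξ, f ξ ∂(μ n : Measure T.Compactification)) := hν.tendsto_comp hc
    have h2 : ∫ ξ, f ξ ∂(ν : Measure _) = l := by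
      by_contra hne
      have := h1.clusterPt
      have h3 := this.mono hl
      exact hne (eq_of_nhds_neBot h3)
    rwa [h2]
  refine ⟨ν, hlim, ?_, ?_⟩
  · rw [Set.range_eq_iUnion]
    refine measure_iUnion_null fun x => ?_
    set n := T.level x with hn
    -- Time `n + 1` is the first that isolates `x`: at time `n` the geodesics to all descendants of
    -- `x` also pass through `x`.
    have hset : ({T.ofVertex x} : Set T.Compactification)
        = {ξ | T.geodesic ξ (n + 1) ∈ ({x} : Set T.V)} := by
      ext ξ
      simp only [Set.mem_singleton_iff, Set.mem_ofPred_eq]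
      constructor
      · rintro rfl
        exact T.anc_of_level_le (by omega)
      · intro hξ
        apply T.geodesic_injective
        rcases ξ with y | γ
        · change T.anc y (n + 1) = x at hξ
          have := T.level_anc y (n + 1)
          rw [hξ] at this
          rw [T.anc_of_level_le (by omega)] at hξ
          rw [← hξ]
          rfl
        · change γ.1 (n + 1) = x at hξ
          have := T.level_boundary γ (n + 1)
          rw [hξ] at this
          omega
    have hclopen : IsClopen ({T.ofVertex x} : Set T.Compactification) := by
      rw [hset]
      exact T.isClopen_cylinder _ _
    -- The singleton is clopen, so its indicator is an admissible test function, and its integral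
    -- vanishes once the sphere has passed level `n`.
    have hcont : Continuous (({T.ofVertex x} : Set T.Compactification).indicator
        (fun _ => (1 : ℝ))) := hclopen.continuous_indicator continuous_const
    have h1 := FiniteMeasure.tendsto_iff_forall_integral_tendsto.1 hlim
      (BoundedContinuousFunction.mkOfCompact ⟨_, hcont⟩)
    simp only [BoundedContinuousFunction.mkOfCompact_apply, ContinuousMap.coe_mk] at h1
    rw [integral_indicator_const _ hclopen.isClosed.measurableSet, smul_eq_mul, mul_one] at h1
    have h2 : ∀ᶠ k in atTop, ∫ ξ, ({T.ofVertex x} : Set T.Compactification).indicator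
        (fun _ => (1 : ℝ)) ξ ∂(μ k : Measure T.Compactification) = 0 := by
      filter_upwards [eventually_gt_atTop n] with k hk
      rw [hμ, T.integral_sphereMeasure _ _ _ hcont.measurable.stronglyMeasurable,
        Finset.sum_eq_zero, mul_zero]
      intro y hy
      rw [mem_sphereFinset] at hy
      refine Set.indicator_of_notMem ?_ _
      rw [Set.mem_singleton_iff]
      rintro hyx
      rw [Sum.inl.inj hyx] at hy
      omega
    have h3 := tendsto_nhds_unique h1 (tendsto_const_nhds.congr' (h2.mono fun _ h => h.symm))
    exact (measureReal_eq_zero_iff).1 h3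
  · have h1 := (NNReal.continuous_coe.tendsto _).comp
      ((FiniteMeasure.continuous_mass.tendsto ν).comp hlim)
    exact h1.congr hmass

end LFRootedTree

/-! ### Isomorphic balls and measurability on the space of trees -/

namespace LFRootedTree

variable {T T' T'' : LFRootedTree}

lemma level_le_succ_of_adj {x y : T.V} (h : T.G.Adj x y) : T.level y ≤ T.level x + 1 := by
  have h1 := T.isTree.connected.dist_triangle (u := T.root) (v := x) (w := y)
  rw [SimpleGraph.dist_eq_one_iff_adj.2 h] at h1
  exact h1

lemma mem_ball_iff {r : ℕ} {x : T.V} : x ∈ T.ball r ↔ T.level x ≤ r := Iff.rfl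

/-- A ball contains the geodesic from the root to each of its points, so the isomorphism can be
followed from parent to child. Applied to the inverse as well, this shows that levels are preserved.
-/
lemma level_ballIso_le {R : ℕ} (φ : T.G.induce (T.ball R) ≃g T'.G.induce (T'.ball R))
    (hφ : φ ⟨T.root, T.root_mem_ball R⟩ = ⟨T'.root, T'.root_mem_ball R⟩) :
    ∀ (n : ℕ) (x : T.ball R), T.level x = n → T'.level (φ x) ≤ n := by
  intro n
  induction n with
  | zero =>
    rintro ⟨x, hx⟩ h
    obtain rfl : x = T.root := T.level_eq_zero.1 h
    rw [hφ, level_root]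
  | succ n ih =>
    rintro ⟨x, hx⟩ h
    change T.level x = n + 1 at h
    have hl : T.level (T.anc x n) = n := by rw [level_anc]; omega
    have hb : T.anc x n ∈ T.ball R := by
      rw [mem_ball_iff] at hx ⊢
      omega
    have hadj : T.G.Adj (T.anc x n) x := by
      have := T.adj_anc_succ (x := x) (i := n) (by omega)
      rwa [T.anc_of_level_le h.le] at this
    have h2 : (T.G.induce (T.ball R)).Adj ⟨_, hb⟩ ⟨x, hx⟩ := hadj
    have h3 : T'.G.Adj (φ ⟨_, hb⟩) (φ ⟨x, hx⟩) := φ.map_adj_iff.2 h2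
    have h4 := ih ⟨_, hb⟩ hl
    have h5 := level_le_succ_of_adj h3
    omega

lemma BallIso.symm {R : ℕ} (h : BallIso R T T') : BallIso R T' T := by
  obtain ⟨φ, hφ⟩ := h
  exact ⟨φ.symm, by rw [← hφ]; exact φ.symm_apply_apply _⟩

lemma BallIso.trans {R : ℕ} (h : BallIso R T T') (h' : BallIso R T' T'') : BallIso R T T'' := by
  obtain ⟨φ, hφ⟩ := h
  obtain ⟨ψ, hψ⟩ := h'
  exact ⟨φ.trans ψ, by change ψ (φ _) = _; rw [hφ, hψ]⟩

lemma level_ballIso {R : ℕ} (φ : T.G.induce (T.ball R) ≃g T'.G.induce (T'.ball R))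
    (hφ : φ ⟨T.root, T.root_mem_ball R⟩ = ⟨T'.root, T'.root_mem_ball R⟩) (x : T.ball R) :
    T'.level (φ x) = T.level x := by
  refine le_antisymm (level_ballIso_le φ hφ _ x rfl) ?_
  have h := level_ballIso_le φ.symm (by rw [← hφ]; exact φ.symm_apply_apply _) _ (φ x) rfl
  have h2 : φ.symm (φ x) = x := φ.symm_apply_apply _
  rwa [h2] at h

/-- The bound on the radius keeps all `n` generations below `x` inside the ball, where the
isomorphism maps children bijectively to children. -/
lemma descendantCount_ballIso {R : ℕ} (φ : T.G.induce (T.ball R) ≃g T'.G.induce (T'.ball R))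
    (hφ : φ ⟨T.root, T.root_mem_ball R⟩ = ⟨T'.root, T'.root_mem_ball R⟩) :
    ∀ (n : ℕ) (x : T.ball R), T.level x + n ≤ R →
      T'.descendantCount n (φ x) = T.descendantCount n x := by
  intro n
  induction n with
  | zero => intro x _; rfl
  | succ n ih =>
    intro x hx
    have hb : ∀ y ∈ T.children x, y ∈ T.ball R := by
      intro y hy
      rw [mem_children] at hy
      rw [mem_ball_iff]
      omega
    symm
    refine Finset.sum_bij (fun y hy => (φ ⟨y, hb y hy⟩).1) ?_ ?_ ?_ ?_
    · intro y hy
      have h1 : (T.G.induce (T.ball R)).Adj x ⟨y, hb y hy⟩ := (T.mem_children.1 hy).1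
      rw [mem_children, level_ballIso φ hφ, level_ballIso φ hφ]
      exact ⟨φ.map_adj_iff.2 h1, (T.mem_children.1 hy).2⟩
    · intro y hy z hz h
      exact congrArg Subtype.val (φ.injective (Subtype.ext h))
    · intro z hz
      rw [mem_children, level_ballIso φ hφ] at hz
      have hzb : z ∈ T'.ball R := by
        rw [mem_ball_iff]
        omega
      obtain ⟨y, hy⟩ := φ.surjective ⟨z, hzb⟩
      have h1 : T.level y = T.level x + 1 := by
        rw [← level_ballIso φ hφ, hy]
        exact hz.2
      have h2 : (T'.G.induce (T'.ball R)).Adj (φ x) (φ y) := by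
        rw [hy]
        exact hz.1
      exact ⟨y, T.mem_children.2 ⟨φ.map_adj_iff.1 h2, h1⟩, by simp [hy]⟩
    · intro y hy
      refine (ih ⟨y, hb y hy⟩ ?_).symm
      rw [mem_children] at hy
      change T.level y + n ≤ R
      omega

lemma BallIso.descendantCount_root {R n : ℕ} (hn : n ≤ R) (h : BallIso R T T') :
    T'.descendantCount n T'.root = T.descendantCount n T.root := by
  obtain ⟨φ, hφ⟩ := h
  have h1 := descendantCount_ballIso φ hφ n ⟨T.root, T.root_mem_ball R⟩ (by simpa)
  rwa [hφ] at h1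

lemma level_iso_le (φ : T.G ≃g T'.G) (hφ : φ T.root = T'.root) (x : T.V) :
    T'.level (φ x) ≤ T.level x := by
  obtain ⟨w, hw⟩ := T.isTree.connected.exists_walk_length_eq_dist T.root x
  rw [level, ← hφ, level, ← hw, ← SimpleGraph.Walk.length_map φ.toHom w]
  exact SimpleGraph.dist_le _

lemma Iso.ballIso (h : Iso T T') (R : ℕ) : BallIso R T T' := by
  obtain ⟨φ, hφ⟩ := h
  have hl : ∀ x, T'.level (φ x) = T.level x := by
    intro x
    refine le_antisymm (level_iso_le φ hφ x) ?_
    have h := level_iso_le φ.symm (by rw [← hφ]; exact φ.symm_apply_apply _) (φ x)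
    have h2 : φ.symm (φ x) = x := φ.symm_apply_apply _
    rwa [h2] at h
  refine ⟨⟨φ.toEquiv.subtypeEquiv fun x => ?_, ?_⟩, ?_⟩
  · rw [mem_ball_iff, mem_ball_iff]
    change _ ↔ T'.level (φ x) ≤ R
    rw [hl]
  · intro a b
    exact φ.map_adj_iff
  · exact Subtype.ext hφ

lemma toClass_eq_iff : T.toClass = T'.toClass ↔ Iso T T' := Quotient.eq

lemma toClass_out (c : TreeSpace) : (Quotient.out c).toClass = c := Quotient.out_eq c

lemma ballIso_out (T : LFRootedTree) (R : ℕ) : BallIso R T (Quotient.out T.toClass) :=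
  (toClass_eq_iff.1 (toClass_out T.toClass).symm).ballIso R

/-- Finite rooted graphs on initial segments of the natural numbers. -/
abbrev FinRootedGraph : Type := Σ n, SimpleGraph (Fin n) × Fin n

instance : Countable FinRootedGraph := by
  have : ∀ n, Countable (SimpleGraph (Fin n)) := fun n =>
    Function.Injective.countable (f := fun G : SimpleGraph (Fin n) => G.Adj)
      fun G H h => SimpleGraph.ext h
  infer_instance

/-- Numbering the finitely many vertices of a ball encodes it in a countable type. -/
lemma exists_code (R : ℕ) (T : LFRootedTree) : ∃ (k : FinRootedGraph)
    (φ : T.G.induce (T.ball R) ≃g k.2.1), φ ⟨T.root, T.root_mem_ball R⟩ = k.2.2 := by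
  have := (T.ball_finite R).to_subtype
  let e := Finite.equivFin (T.ball R)
  exact ⟨⟨_, (T.G.induce (T.ball R)).map e.toEmbedding, e ⟨T.root, T.root_mem_ball R⟩⟩,
    SimpleGraph.Iso.map e _, rfl⟩

/-- A set of rooted trees that depends on the ball of radius `R` only is measurable. -/
lemma measurableSet_of_ballIso (R : ℕ) {Q : LFRootedTree → Prop}
    (hQ : ∀ T T', BallIso R T T' → Q T → Q T') :
    MeasurableSet {c : TreeSpace | Q (Quotient.out c)} := by
  choose code φ hφ using exists_code R
  have hcode : ∀ T T', code T = code T' → BallIso R T T' := by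
    intro T T' h
    have h1 := hφ T
    have h2 := hφ T'
    revert h1 h2
    generalize φ T = φ₁
    generalize φ T' = φ₂
    revert φ₁ φ₂
    rw [h]
    intro φ₁ φ₂ h1 h2
    refine ⟨φ₁.trans φ₂.symm, ?_⟩
    change φ₂.symm (φ₁ _) = _
    rw [h1, ← h2]
    exact φ₂.symm_apply_apply _
  -- The set is a countable union of generators of the σ-algebra, one for each code realized by a
  -- tree with property `Q`.
  have hset : {c : TreeSpace | Q (Quotient.out c)}
      = ⋃ k : {k : FinRootedGraph // ∃ T, Q T ∧ code T = k},
          LFRootedTree.toClass '' {T' | BallIso R k.2.choose T'} := by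
    ext c
    simp only [Set.mem_ofPred_eq, Set.mem_iUnion, Set.mem_image]
    constructor
    · intro hc
      let k : {k : FinRootedGraph // ∃ T, Q T ∧ code T = k} :=
        ⟨code (Quotient.out c), _, hc, rfl⟩
      exact ⟨k, Quotient.out c, hcode _ _ k.2.choose_spec.2, toClass_out c⟩
    · rintro ⟨k, T', hT', rfl⟩
      exact hQ _ _ (ballIso_out T' R) (hQ _ _ hT' k.2.choose_spec.1)
  rw [hset]
  exact MeasurableSet.iUnion fun k => MeasurableSpace.measurableSet_generateFrom ⟨_, R, rfl⟩

/-- The normalized numbers of descendants of all vertices converge. -/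
def HasLimits (m : ℝ≥0) (T : LFRootedTree) : Prop :=
  ∀ x, ∃ w : ℝ, Tendsto (fun n => (T.descendantCount n x : ℝ) / (m : ℝ) ^ n) atTop (𝓝 w)

/-- The normalized numbers of descendants of the vertices at level `r` in the generations
`p.1` and `p.2` are close. -/
def CauchyAt (m : ℝ≥0) (r l : ℕ) (p : ℕ × ℕ) (T : LFRootedTree) : Prop :=
  ∀ x, T.level x = r → dist ((T.descendantCount p.1 x : ℝ) / (m : ℝ) ^ p.1)
    ((T.descendantCount p.2 x : ℝ) / (m : ℝ) ^ p.2) < 1 / ((l : ℝ) + 1)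

/-- The Cauchy criterion removes the unknown limits, and finiteness of spheres lets "eventually"
absorb the quantifier over vertices. What remains is a countable combination of conditions, each on
a ball of bounded radius. -/
lemma hasLimits_iff {m : ℝ≥0} :
    T.HasLimits m ↔ ∀ r l, ∀ᶠ p : ℕ × ℕ in atTop, T.CauchyAt m r l p := by
  have h1 : ∀ x, (∃ w : ℝ, Tendsto (fun n => (T.descendantCount n x : ℝ) / (m : ℝ) ^ n) atTop
      (𝓝 w)) ↔ ∀ l : ℕ, ∀ᶠ p : ℕ × ℕ in atTop,
        dist ((T.descendantCount p.1 x : ℝ) / (m : ℝ) ^ p.1)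
          ((T.descendantCount p.2 x : ℝ) / (m : ℝ) ^ p.2) < 1 / ((l : ℝ) + 1) := by
    intro x
    have h0 : ∀ u : ℕ → ℝ, (∃ w, Tendsto u atTop (𝓝 w)) ↔ CauchySeq u := fun u =>
      ⟨fun ⟨_, h⟩ => h.cauchySeq, cauchySeq_tendsto_of_complete⟩
    rw [h0, cauchySeq_iff_tendsto_dist_atTop_0, Metric.tendsto_nhds]
    simp only [Real.dist_0_eq_abs, abs_dist]
    refine ⟨fun h l => h _ Nat.one_div_pos_of_nat, fun h ε hε => ?_⟩
    obtain ⟨l, hl⟩ := exists_nat_one_div_lt hε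
    exact (h l).mono fun p hp => hp.trans hl
  have h2 : ∀ r l, (∀ᶠ p : ℕ × ℕ in atTop, T.CauchyAt m r l p) ↔ ∀ x ∈ T.sphereFinset r,
      ∀ᶠ p : ℕ × ℕ in atTop, dist ((T.descendantCount p.1 x : ℝ) / (m : ℝ) ^ p.1)
          ((T.descendantCount p.2 x : ℝ) / (m : ℝ) ^ p.2) < 1 / ((l : ℝ) + 1) := by
    intro r l
    rw [← Filter.eventually_all_finset]
    simp only [mem_sphereFinset]
    rfl
  simp only [HasLimits, h1, h2, mem_sphereFinset]
  exact ⟨fun h r l x _ => h x l, fun h x l => h _ l x rfl⟩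

lemma CauchyAt.of_ballIso {m : ℝ≥0} {r l : ℕ} {p : ℕ × ℕ}
    (h : BallIso (r + p.1 + p.2) T T') (hT : T.CauchyAt m r l p) : T'.CauchyAt m r l p := by
  obtain ⟨φ, hφ⟩ := h
  intro x hx
  obtain ⟨y, hy⟩ := φ.surjective ⟨x, by rw [mem_ball_iff]; omega⟩
  have hl : T.level y = r := by
    rw [← level_ballIso φ hφ, hy]
    exact hx
  have h1 := descendantCount_ballIso φ hφ p.1 y (by omega)
  have h2 := descendantCount_ballIso φ hφ p.2 y (by omega)
  rw [hy] at h1 h2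
  change T'.descendantCount p.1 x = _ at h1
  change T'.descendantCount p.2 x = _ at h2
  rw [h1, h2]
  exact hT y hl

lemma HasLimits.of_iso {m : ℝ≥0} (h : Iso T T') (hT : T.HasLimits m) : T'.HasLimits m := by
  rw [hasLimits_iff] at hT ⊢
  exact fun r l => (hT r l).mono fun p hp => hp.of_ballIso (h.ballIso _)

lemma measurableSet_hasLimits (m : ℝ≥0) :
    MeasurableSet {c : TreeSpace | HasLimits m (Quotient.out c)} := by
  have : {c : TreeSpace | HasLimits m (Quotient.out c)} = ⋂ r : ℕ, ⋂ l : ℕ, ⋃ q : ℕ × ℕ,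
      ⋂ p : ℕ × ℕ, ⋂ _ : q ≤ p, {c : TreeSpace | CauchyAt m r l p (Quotient.out c)} := by
    ext c
    simp only [Set.mem_ofPred_eq, hasLimits_iff, Set.mem_iInter, Set.mem_iUnion,
      Filter.eventually_atTop]
  rw [this]
  exact MeasurableSet.iInter fun r => MeasurableSet.iInter fun l => MeasurableSet.iUnion fun q =>
    MeasurableSet.iInter fun p => MeasurableSet.iInter fun _ =>
      measurableSet_of_ballIso (r + p.1 + p.2) fun _ _ h hT => hT.of_ballIso h

/-- The number of vertices at distance `n` from the root. -/
noncomputable def sphereCard (n : ℕ) (c : TreeSpace) : ℕ :=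
  (Quotient.out c).descendantCount n (Quotient.out c).root

lemma sphereCard_toClass (n : ℕ) (T : LFRootedTree) :
    sphereCard n T.toClass = T.descendantCount n T.root :=
  (ballIso_out T n).descendantCount_root le_rfl

lemma measurable_sphereCard (n : ℕ) : Measurable (sphereCard n) := by
  refine measurable_to_countable' fun j => ?_
  exact measurableSet_of_ballIso n (Q := fun T => T.descendantCount n T.root = j)
    fun T T' h hT => (h.descendantCount_root le_rfl).trans hT

end LFRootedTree

/-! ### The genealogical tree in Ulam–Harris labels -/

namespace GaltonWatson

/-- The number of descendants of the individual `v` in the `n`-th generation after `v`, provided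
that `v` is born. -/
def population (k : List ℕ → ℕ) : ℕ → List ℕ → ℕ
  | 0, _ => 1
  | n + 1, v => ∑ i ∈ Finset.range (k v), population k n (i :: v)

/-- The label of a vertex of the genealogical tree. -/
def label {k : List ℕ → ℕ} (v : (tree k).V) : List ℕ := Subtype.val (p := IsBorn k) v

/-- The vertex of the genealogical tree with a given label. -/
def vertex {k : List ℕ → ℕ} (v : List ℕ) (hv : IsBorn k v) : (tree k).V :=
  (⟨v, hv⟩ : {v : List ℕ // IsBorn k v})

lemma isBorn_label {k : List ℕ → ℕ} (v : (tree k).V) : IsBorn k (label v) := Subtype.prop _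

lemma label_injective {k : List ℕ → ℕ} : Function.Injective (label (k := k)) :=
  Subtype.val_injective

lemma adj_tree {k : List ℕ → ℕ} {u v : (tree k).V} :
    (tree k).G.Adj u v ↔ (∃ i, label v = i :: label u) ∨ ∃ i, label u = i :: label v := Iff.rfl

lemma length_label_le_of_walk {k : List ℕ → ℕ} {a b : (tree k).V} (w : (tree k).G.Walk a b) :
    (label b).length ≤ (label a).length + w.length := by
  induction w with
  | nil => simp
  | @cons a c b h w ih =>
    rw [SimpleGraph.Walk.length_cons]
    rcases adj_tree.1 h with ⟨i, h⟩ | ⟨i, h⟩ <;>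
    · have := congrArg List.length h
      simp only [List.length_cons] at this
      omega

lemma level_tree {k : List ℕ → ℕ} (v : (tree k).V) : (tree k).level v = (label v).length := by
  apply le_antisymm
  · have key : ∀ (v : List ℕ) (hv : IsBorn k v), (tree k).level (vertex v hv) ≤ v.length := by
      intro v
      induction v with
      | nil => intro _; exact ((tree k).level_root).le
      | cons i v ih =>
        intro hv
        have h1 : (tree k).G.Adj (vertex v hv.2) (vertex (i :: v) hv) := Or.inl ⟨i, rfl⟩
        have h2 := LFRootedTree.level_le_succ_of_adj h1
        have h3 := ih hv.2
        simp only [List.length_cons]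
        omega
    exact key _ (isBorn_label v)
  · obtain ⟨w, hw⟩ := (tree k).isTree.connected.exists_walk_length_eq_dist (tree k).root v
    have h1 := length_label_le_of_walk w
    have h2 : label (tree k).root = [] := rfl
    rw [h2, List.length_nil, zero_add] at h1
    exact h1.trans hw.le

lemma mem_children_tree {k : List ℕ → ℕ} {u v : (tree k).V} :
    v ∈ (tree k).children u ↔ ∃ i, label v = i :: label u := by
  rw [LFRootedTree.mem_children, level_tree, level_tree, adj_tree]
  constructor
  · rintro ⟨h | ⟨i, h⟩, hl⟩
    · exact h
    · rw [h] at hl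
      simp at hl
      omega
  · rintro ⟨i, h⟩
    exact ⟨Or.inl ⟨i, h⟩, by simp [h]⟩

lemma descendantCount_tree {k : List ℕ → ℕ} : ∀ (n : ℕ) (v : (tree k).V),
    (tree k).descendantCount n v = population k n (label v) := by
  intro n
  induction n with
  | zero => intro v; rfl
  | succ n ih =>
    intro v
    symm
    refine Finset.sum_bij
      (fun i hi => vertex (i :: label v) ⟨Finset.mem_range.1 hi, isBorn_label v⟩) ?_ ?_ ?_ ?_
    · intro i hi
      exact mem_children_tree.2 ⟨i, rfl⟩
    · intro i hi j hj h
      exact (List.cons.inj (congrArg label h)).1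
    · intro u hu
      obtain ⟨i, h⟩ := mem_children_tree.1 hu
      have hb := isBorn_label u
      rw [h] at hb
      exact ⟨i, Finset.mem_range.2 hb.1, label_injective h.symm⟩
    · intro i hi
      rw [ih]
      rfl

lemma mem_ball_tree {k : List ℕ → ℕ} {R : ℕ} {v : (tree k).V} :
    v ∈ (tree k).ball R ↔ (label v).length ≤ R := by
  rw [LFRootedTree.mem_ball_iff, level_tree]

lemma isBorn_congr {k k' : List ℕ → ℕ} {R : ℕ}
    (h : ∀ v, IsBorn k v → v.length ≤ R → k' v = k v) :
    ∀ v : List ℕ, v.length ≤ R → (IsBorn k v ↔ IsBorn k' v) := by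
  intro v
  induction v with
  | nil => intro _; rfl
  | cons i v ih =>
    intro hv
    simp only [List.length_cons] at hv
    have h1 := ih (by omega)
    constructor
    · rintro ⟨h2, h3⟩
      exact ⟨by rwa [h v h3 (by omega)], h1.1 h3⟩
    · rintro ⟨h2, h3⟩
      have h4 := h1.2 h3
      exact ⟨by rwa [← h v h4 (by omega)], h4⟩

lemma ballIso_of_eqOn {k k' : List ℕ → ℕ} {R : ℕ}
    (h : ∀ v, IsBorn k v → v.length ≤ R → k' v = k v) :
    LFRootedTree.BallIso R (tree k) (tree k') := by
  have hb := isBorn_congr h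
  have hl : ∀ (k : List ℕ → ℕ) (v : (tree k).ball R), (label v.1).length ≤ R :=
    fun k v => mem_ball_tree.1 v.2
  exact ⟨⟨⟨fun v => ⟨vertex (label v.1) ((hb _ (hl k v)).1 (isBorn_label v.1)),
      mem_ball_tree.2 (hl k v)⟩,
    fun v => ⟨vertex (label v.1) ((hb _ (hl k' v)).2 (isBorn_label v.1)),
      mem_ball_tree.2 (hl k' v)⟩, fun _ => rfl, fun _ => rfl⟩, Iff.rfl⟩, rfl⟩

/-- The `R`-ball of `tree k` is determined by the finitely many offspring numbers inside it, hence
is locally constant in `k` for the product topology. -/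
lemma isOpen_ballIso (T : LFRootedTree) (R : ℕ) :
    IsOpen {k : List ℕ → ℕ | LFRootedTree.BallIso R T (tree k)} := by
  rw [isOpen_iff_mem_nhds]
  intro k hk
  have hfin : (label '' (tree k).ball R : Set (List ℕ)).Finite :=
    ((tree k).ball_finite R).image _
  have hU : Set.pi (label '' (tree k).ball R : Set (List ℕ)) (fun v => {k v}) ∈ 𝓝 k :=
    set_pi_mem_nhds hfin fun v _ => by simp
  refine mem_of_superset hU fun k' hk' => ?_
  refine LFRootedTree.BallIso.trans hk (ballIso_of_eqOn fun v hv hvR => ?_)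
  exact hk' v ⟨vertex v hv, mem_ball_tree.2 hvR, rfl⟩

lemma measurable_toClass_tree : Measurable fun k : List ℕ → ℕ => (tree k).toClass := by
  refine measurable_generateFrom ?_
  rintro _ ⟨T, R, rfl⟩
  have : (fun k : List ℕ → ℕ => (tree k).toClass) ⁻¹'
      (LFRootedTree.toClass '' {T' | LFRootedTree.BallIso R T T'})
      = {k | LFRootedTree.BallIso R T (tree k)} := by
    ext k
    constructor
    · rintro ⟨T', hT', h⟩
      exact LFRootedTree.BallIso.trans hT' ((LFRootedTree.toClass_eq_iff.1 h).ballIso R)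
    · intro h
      exact ⟨_, h, rfl⟩
  rw [this]
  exact (isOpen_ballIso T R).measurableSet

end GaltonWatson

/-! ### Independence of subtrees and the martingale of generation sizes -/

namespace GaltonWatson

open ProbabilityTheory

/-- The law of independent numbers of children with distributions `q v`. -/
noncomputable def offspringLaw (q : List ℕ → PMF ℕ) : Measure (List ℕ → ℕ) :=
  Measure.infinitePi fun v => (q v).toMeasure

instance (q : List ℕ → PMF ℕ) : IsProbabilityMeasure (offspringLaw q) := by
  unfold offspringLaw
  infer_instance

/-- The σ-algebra generated by the numbers of children of the individuals in `S`. -/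
@[reducible]
def coordAlgebra (S : Set (List ℕ)) : MeasurableSpace (List ℕ → ℕ) :=
  ⨆ v ∈ S, MeasurableSpace.comap (fun k => k v) inferInstance

lemma coordAlgebra_le (S : Set (List ℕ)) : coordAlgebra S ≤ MeasurableSpace.pi :=
  iSup₂_le fun v _ => (measurable_pi_apply v).comap_le

lemma coordAlgebra_mono {S S' : Set (List ℕ)} (h : S ⊆ S') : coordAlgebra S ≤ coordAlgebra S' :=
  biSup_mono h

lemma measurable_coord {S : Set (List ℕ)} {v : List ℕ} (hv : v ∈ S) :
    Measurable[coordAlgebra S] fun k : List ℕ → ℕ => k v :=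
  Measurable.of_comap_le (le_iSup₂_of_le v hv le_rfl)

lemma indep_coordAlgebra (q : List ℕ → PMF ℕ) {S S' : Set (List ℕ)} (h : Disjoint S S') :
    Indep (coordAlgebra S) (coordAlgebra S') (offspringLaw q) := by
  refine indep_iSup_of_disjoint (fun v => (measurable_pi_apply v).comap_le) ?_ h
  exact iIndepFun_infinitePi (P := fun v => (q v).toMeasure) (X := fun _ j => j)
    fun _ => measurable_id

lemma lintegral_mul_of_disjoint (q : List ℕ → PMF ℕ) {S S' : Set (List ℕ)} (h : Disjoint S S')
    {f g : (List ℕ → ℕ) → ℝ≥0∞} (hf : Measurable[coordAlgebra S] f)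
    (hg : Measurable[coordAlgebra S'] g) :
    ∫⁻ k, f k * g k ∂offspringLaw q
      = (∫⁻ k, f k ∂offspringLaw q) * ∫⁻ k, g k ∂offspringLaw q :=
  lintegral_mul_eq_lintegral_mul_lintegral_of_independent_measurableSpace (coordAlgebra_le S)
    (coordAlgebra_le S') (indep_coordAlgebra q h) hf hg

lemma map_coord (q : List ℕ → PMF ℕ) (v : List ℕ) :
    (offspringLaw q).map (fun k => k v) = (q v).toMeasure :=
  Measure.infinitePi_map_eval _ v

lemma lintegral_toMeasure (r : PMF ℕ) (f : ℕ → ℝ≥0∞) :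
    ∫⁻ j, f j ∂r.toMeasure = ∑' j, f j * r j := by
  rw [lintegral_countable']
  exact tsum_congr fun j => by rw [PMF.toMeasure_apply_singleton _ _ (MeasurableSet.singleton j)]

lemma lintegral_coord (q : List ℕ → PMF ℕ) (v : List ℕ) (f : ℕ → ℝ≥0∞) :
    ∫⁻ k, f (k v) ∂offspringLaw q = ∑' j, f j * q v j := by
  have h := lintegral_map (μ := offspringLaw q) (f := f) (g := fun k => k v)
    (measurable_of_countable _) (measurable_pi_apply v)
  rw [← h, map_coord, lintegral_toMeasure]

lemma measurable_comp_nat {Ω M : Type*} {mΩ : MeasurableSpace Ω} [MeasurableSpace M]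
    {a : Ω → ℕ} {F : ℕ → Ω → M} (ha : Measurable a) (hF : ∀ j, Measurable (F j)) :
    Measurable fun ω => F (a ω) ω :=
  (measurable_from_prod_countable_right (f := fun x : ℕ × Ω => F x.1 x.2) hF).comp
    (ha.prodMk measurable_id)

/-- Descendants of `v` are the words with suffix `v`. Keeping both the suffix and the length
restriction serves two purposes: adaptedness to generations and independence of disjoint subtrees.
-/
lemma measurable_population {S : Set (List ℕ)} : ∀ (n : ℕ) (v : List ℕ),
    (∀ w, v <:+ w → w.length < v.length + n → w ∈ S) →
      Measurable[coordAlgebra S] fun k => population k n v := by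
  intro n
  induction n with
  | zero => intro v _; exact @measurable_const _ _ _ (coordAlgebra S) _
  | succ n ih =>
    intro v hS
    simp only [population]
    refine @measurable_comp_nat _ _ (coordAlgebra S) _ (fun k => k v)
      (fun j k => ∑ i ∈ Finset.range j, population k n (i :: v))
      (measurable_coord (hS v List.suffix_rfl (by omega))) fun j => ?_
    refine Finset.measurable_fun_sum _ fun i _ => ih (i :: v) fun w hw hl => ?_
    refine hS w ((List.suffix_cons i v).trans hw) ?_
    simp only [List.length_cons] at hl
    omega

lemma measurable_population' (n : ℕ) (v : List ℕ) : Measurable fun k => population k n v :=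
  (measurable_population (S := Set.univ) n v fun _ _ _ => trivial).mono (coordAlgebra_le _) le_rfl

/-- Turns a sum with a random number of terms into a series of indicators, which can be integrated
term by term. -/
lemma sum_range_eq_tsum (j : ℕ) (F : ℕ → ℝ≥0∞) :
    ∑ i ∈ Finset.range j, F i = ∑' i, if i < j then F i else 0 := by
  rw [tsum_eq_sum (s := Finset.range j)]
  · exact Finset.sum_congr rfl fun i hi => (if_pos (Finset.mem_range.1 hi)).symm
  · intro i hi
    exact if_neg fun h => hi (Finset.mem_range.2 h)

lemma coe_population_succ (k : List ℕ → ℕ) (n : ℕ) (v : List ℕ) :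
    (population k (n + 1) v : ℝ≥0∞) = ∑' i, if i < k v then (population k n (i :: v) : ℝ≥0∞) else 0 := by
  rw [population, Nat.cast_sum, sum_range_eq_tsum]

/-- The mean of a distribution, with values in `[0, ∞]`. -/
noncomputable def emean (p : PMF ℕ) : ℝ≥0∞ := ∑' j : ℕ, j * p j

variable {p : PMF ℕ} {q : List ℕ → PMF ℕ}

/-- The martingale property in integrated form. One splits by the children of `v` and absorbs the
event `i < k v` into `A`, which stays admissible because a child's label is one letter longer. In
the base case `k v` is independent of the offspring numbers of shorter words. -/
lemma setLIntegral_population_succ (hq : ∀ v, v ≠ [] → q v = p) : ∀ (n : ℕ) (v : List ℕ), v ≠ [] →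
    ∀ A : Set (List ℕ → ℕ), MeasurableSet[coordAlgebra {w | w.length < v.length + n}] A →
      ∫⁻ k in A, (population k (n + 1) v : ℝ≥0∞) ∂offspringLaw q
        = emean p * ∫⁻ k in A, (population k n v : ℝ≥0∞) ∂offspringLaw q := by
  intro n
  induction n with
  | zero =>
    intro v hv A hA
    have hA' : MeasurableSet A := coordAlgebra_le _ _ hA
    have h1 := lintegral_mul_of_disjoint q
      (S := {w | w.length < v.length + 0}) (S' := {v}) (by simp)
      (f := A.indicator fun _ => 1) (g := fun k => (k v : ℝ≥0∞))
      ((@measurable_const _ _ _ (coordAlgebra _) _).indicator hA)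
      ((measurable_of_countable (fun j : ℕ => (j : ℝ≥0∞))).comp (measurable_coord rfl))
    rw [lintegral_coord q v (fun j => (j : ℝ≥0∞)), hq v hv, lintegral_indicator hA'] at h1
    simp only [population, Finset.sum_const, Finset.card_range, smul_eq_mul, mul_one, Nat.cast_one]
    rw [mul_comm (emean p), emean, ← h1, ← lintegral_indicator hA']
    refine lintegral_congr fun k => ?_
    by_cases hk : k ∈ A <;> simp [hk]
  | succ n ih =>
    intro v hv A hA
    have hA' : MeasurableSet A := coordAlgebra_le _ _ hA
    have hB : ∀ i, MeasurableSet {k : List ℕ → ℕ | i < k v} := fun i =>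
      measurableSet_lt measurable_const (measurable_pi_apply v)
    have key : ∀ n, ∫⁻ k in A, (population k (n + 1) v : ℝ≥0∞) ∂offspringLaw q
        = ∑' i, ∫⁻ k in {k | i < k v} ∩ A, (population k n (i :: v) : ℝ≥0∞) ∂offspringLaw q := by
      intro n
      simp only [coe_population_succ]
      rw [lintegral_tsum]
      · refine tsum_congr fun i => ?_
        rw [← Measure.restrict_restrict (hB i), ← lintegral_indicator (hB i)]
        refine lintegral_congr fun k => ?_
        simp only [Set.indicator_apply, Set.mem_ofPred_eq]
      · intro i
        exact (Measurable.ite (hB i) ((measurable_of_countable _).comp (measurable_population' n _))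
          measurable_const).aemeasurable
    rw [key, key, ← ENNReal.tsum_mul_left]
    refine tsum_congr fun i => ih (i :: v) (by simp) _ ?_
    have hle : coordAlgebra {w : List ℕ | w.length < v.length + (n + 1)}
        ≤ coordAlgebra {w : List ℕ | w.length < (i :: v).length + n} := by
      refine coordAlgebra_mono fun w hw => ?_
      simp only [Set.mem_ofPred_eq, List.length_cons] at hw ⊢
      omega
    refine MeasurableSet.inter ?_ (hle _ hA)
    exact measurable_coord (S := {w : List ℕ | w.length < (i :: v).length + n}) (v := v)
      (by simp only [Set.mem_ofPred_eq, List.length_cons]; omega) (measurableSet_Ioi (a := i))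

lemma lintegral_population (hq : ∀ v, v ≠ [] → q v = p) (n : ℕ) {v : List ℕ} (hv : v ≠ []) :
    ∫⁻ k, (population k n v : ℝ≥0∞) ∂offspringLaw q = emean p ^ n := by
  induction n with
  | zero => simp [population]
  | succ n ih =>
    have := setLIntegral_population_succ hq n v hv Set.univ MeasurableSet.univ
    rw [setLIntegral_univ, setLIntegral_univ, ih] at this
    rw [this, pow_succ']

/-- The normalized numbers of descendants converge almost surely. -/
theorem ae_exists_tendsto_population (hq : ∀ v, v ≠ [] → q v = p) {m : ℝ≥0} (hm0 : 0 < m)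
    (hm : emean p = m) {v : List ℕ} (hv : v ≠ []) :
    ∀ᵐ k ∂offspringLaw q, ∃ w : ℝ,
      Tendsto (fun n => (population k n v : ℝ) / (m : ℝ) ^ n) atTop (𝓝 w) := by
  let ℱ : Filtration ℕ (MeasurableSpace.pi : MeasurableSpace (List ℕ → ℕ)) :=
    { seq := fun n => coordAlgebra {w | w.length < v.length + n}
      mono' := fun i j hij => coordAlgebra_mono fun w hw => by
        simp only [Set.mem_ofPred_eq] at hw ⊢
        omega
      le' := fun n => coordAlgebra_le _ }
  set f : ℕ → (List ℕ → ℕ) → ℝ := fun n k => (population k n v : ℝ) / (m : ℝ) ^ n with hf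
  have hmeas : ∀ n, Measurable[ℱ n] (f n) := by
    intro n
    have h1 : Measurable[coordAlgebra {w | w.length < v.length + n}]
        fun k => population k n v := measurable_population n v fun w _ h => h
    exact (measurable_of_countable fun j : ℕ => (j : ℝ) / (m : ℝ) ^ n).comp h1
  have hmr : (0 : ℝ) < m := by exact_mod_cast hm0
  have hnn : ∀ n k, 0 ≤ f n k := fun n k => by positivity
  have hofReal : ∀ n k, ENNReal.ofReal (f n k) = (population k n v : ℝ≥0∞) * ((m : ℝ≥0∞) ^ n)⁻¹ := by
    intro n k
    rw [hf, ENNReal.ofReal_div_of_pos (by positivity), ENNReal.ofReal_natCast,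
      ENNReal.ofReal_pow hmr.le, ENNReal.ofReal_coe_nnreal, div_eq_mul_inv]
  have hset : ∀ n A, ∫⁻ k in A, ENNReal.ofReal (f n k) ∂offspringLaw q
      = (∫⁻ k in A, (population k n v : ℝ≥0∞) ∂offspringLaw q) * ((m : ℝ≥0∞) ^ n)⁻¹ := by
    intro n A
    simp only [hofReal]
    exact lintegral_mul_const _ ((measurable_of_countable _).comp (measurable_population' n v))
  have hme : (m : ℝ≥0∞) ≠ 0 := by exact_mod_cast hm0.ne'
  have hone : ∀ n, ∫⁻ k, ENNReal.ofReal (f n k) ∂offspringLaw q = 1 := by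
    intro n
    have := hset n Set.univ
    rw [setLIntegral_univ, setLIntegral_univ, lintegral_population hq n hv, hm] at this
    rw [this, ENNReal.mul_inv_cancel (pow_ne_zero _ hme) (by finiteness)]
  have hint : ∀ n, Integrable (f n) (offspringLaw q) := by
    intro n
    refine ⟨((hmeas n).mono (ℱ.le n) le_rfl).aestronglyMeasurable, ?_⟩
    rw [hasFiniteIntegral_iff_ofReal (ae_of_all _ (hnn n)), hone]
    exact ENNReal.one_lt_top
  have hmart : Martingale f ℱ (offspringLaw q) := by
    refine martingale_of_setIntegral_eq_succ (fun n => (hmeas n).stronglyMeasurable) hint ?_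
    intro n A hA
    rw [integral_eq_lintegral_of_nonneg_ae (ae_of_all _ (hnn n)) (hint n).1.restrict,
      integral_eq_lintegral_of_nonneg_ae (ae_of_all _ (hnn _)) (hint _).1.restrict, hset, hset,
      setLIntegral_population_succ hq n v hv A hA, hm, pow_succ',
      ENNReal.mul_inv (Or.inl hme) (Or.inl (by finiteness))]
    congr 1
    rw [mul_mul_mul_comm, ENNReal.mul_inv_cancel hme (by finiteness), one_mul]
  -- Nonnegativity makes every $L^1$ norm equal to the mean, which is one.
  refine hmart.submartingale.exists_ae_tendsto_of_bdd (R := 1) fun n => ?_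
  rw [eLpNorm_one_eq_lintegral_enorm]
  refine le_of_eq ?_
  rw [ENNReal.coe_one, ← hone n]
  refine lintegral_congr fun k => ?_
  rw [Real.enorm_of_nonneg (hnn n k)]

end GaltonWatson

/-! ### Generating functions of the generations -/

namespace GaltonWatson

variable {p : PMF ℕ} {q : List ℕ → PMF ℕ}

/-- The generating function of a distribution. -/
noncomputable def genFun (p : PMF ℕ) (t : ℝ≥0∞) : ℝ≥0∞ := ∑' j, p j * t ^ j

lemma measurable_pow_population (a : ℝ≥0∞) {S : Set (List ℕ)} (n : ℕ) (v : List ℕ)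
    (h : ∀ w, v <:+ w → w ∈ S) : Measurable[coordAlgebra S] fun k => a ^ population k n v :=
  (measurable_of_countable fun j : ℕ => a ^ j).comp (measurable_population n v fun w hw _ => h w hw)

lemma eq_of_cons_suffix {i j : ℕ} {v w : List ℕ} (hi : i :: v <:+ w) (hj : j :: v <:+ w) :
    i = j := by
  have h := List.suffix_of_suffix_length_le hi hj (by simp)
  exact (List.cons.inj (h.eq_of_length (by simp))).1

/-- The number `j` of factors is decoupled from the value `l` of `k v` so that one can induct on
`j`, splitting off one independent subtree at a time; it is applied with `j = l`. -/
lemma lintegral_prod_pow_population (hq : ∀ v, v ≠ [] → q v = p) {a G : ℝ≥0∞} {n : ℕ}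
    (hG : ∀ v, v ≠ [] → ∫⁻ k, a ^ population k n v ∂offspringLaw q = G) {v : List ℕ}
    (hv : v ≠ []) (l j : ℕ) :
    ∫⁻ k, (if k v = l then 1 else 0) * ∏ i ∈ Finset.range j, a ^ population k n (i :: v)
      ∂offspringLaw q = p l * G ^ j := by
  induction j with
  | zero =>
    simp only [Finset.range_zero, Finset.prod_empty, mul_one, pow_zero]
    rw [lintegral_coord q v (fun j => if j = l then 1 else 0), hq v hv, tsum_eq_single l]
    · simp
    · intro j hj
      simp [hj]
  | succ j ih =>
    simp only [Finset.prod_range_succ, ← mul_assoc]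
    set S : Set (List ℕ) := {w | w = v ∨ ∃ i < j, i :: v <:+ w} with hS
    rw [lintegral_mul_of_disjoint q (S := S) (S' := {w | j :: v <:+ w}), ih,
      hG _ (by simp), pow_succ, mul_assoc]
    · rw [Set.disjoint_left]
      rintro w (rfl | ⟨i, hi, h⟩) h'
      · have := List.IsSuffix.length_le h'
        simp at this
      · exact hi.ne (eq_of_cons_suffix h h')
    · refine Measurable.mul ?_ ?_
      · exact (measurable_of_countable fun j : ℕ => if j = l then (1 : ℝ≥0∞) else 0).comp
          (measurable_coord (Or.inl rfl))
      · refine Finset.measurable_fun_prod _ fun i hi => measurable_pow_population a n _ fun w hw => ?_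
        exact Or.inr ⟨i, Finset.mem_range.1 hi, hw⟩
    · exact measurable_pow_population a n _ fun w hw => hw

/-- The generating function of the `n`-th generation is the `n`-th iterate of the generating
function of the offspring distribution. -/
theorem lintegral_pow_population (hq : ∀ v, v ≠ [] → q v = p) (a : ℝ≥0∞) (n : ℕ) :
    ∀ v, v ≠ [] → ∫⁻ k, a ^ population k n v ∂offspringLaw q = (genFun p)^[n] a := by
  induction n with
  | zero => intro v _; simp [population]
  | succ n ih =>
    intro v hv
    have h1 : ∀ k, a ^ population k (n + 1) v = ∑' l, (if k v = l then 1 else 0) *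
        ∏ i ∈ Finset.range l, a ^ population k n (i :: v) := by
      intro k
      rw [tsum_eq_single (k v)]
      · rw [if_pos rfl, one_mul, Finset.prod_pow_eq_pow_sum, population]
      · intro l hl
        rw [if_neg hl.symm, zero_mul]
    simp only [h1]
    rw [lintegral_tsum, Function.iterate_succ_apply', genFun]
    · exact tsum_congr fun l => lintegral_prod_pow_population hq ih hv l l
    · intro l
      refine (Measurable.mul ?_ ?_).aemeasurable
      · exact (measurable_of_countable fun j : ℕ => if j = l then (1 : ℝ≥0∞) else 0).comp
          (measurable_pi_apply v)
      · refine Finset.measurable_fun_prod _ fun i _ => ?_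
        exact (measurable_of_countable fun j : ℕ => a ^ j).comp (measurable_population' n _)

end GaltonWatson

/-! ### The mean and the estimates under the $L\log L$ condition -/

namespace GaltonWatson

variable {p : PMF ℕ}

lemma hasSum_toReal (p : PMF ℕ) : HasSum (fun j => (p j).toReal) 1 := by
  rw [← ENNReal.toReal_one, ← p.tsum_coe, ENNReal.tsum_toReal_eq p.apply_ne_top]
  exact ENNReal.hasSum_toReal p.tsum_coe_ne_top

/-- Because $j\le j\log j+2$: the constant covers $j\le2$, and $\log j\ge1$ for $j\ge3>e$. -/
lemma summable_mul_toReal (hlog : Summable fun j : ℕ => (j : ℝ) * Real.log j * (p j).toReal) :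
    Summable fun j : ℕ => (j : ℝ) * (p j).toReal := by
  refine Summable.of_nonneg_of_le (fun j => by positivity) (fun j => ?_)
    (hlog.add ((hasSum_toReal p).summable.mul_left 2))
  rw [← add_mul]
  gcongr
  rcases le_or_gt j 2 with h | h
  · have h1 : (j : ℝ) ≤ 2 := by exact_mod_cast h
    have h2 : 0 ≤ (j : ℝ) * Real.log j := mul_nonneg (by positivity) (Real.log_natCast_nonneg j)
    linarith
  · have h1 : (3 : ℝ) ≤ j := by exact_mod_cast h
    have h2 : 1 ≤ Real.log j := by
      rw [Real.le_log_iff_exp_le (by linarith)]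
      linarith [Real.exp_one_lt_d9]
    nlinarith

lemma summable_mul_toNNReal (h1 : Summable fun j : ℕ => (j : ℝ) * (p j).toReal) :
    Summable fun j : ℕ => (j : ℝ≥0) * (p j).toNNReal := by
  rw [← NNReal.summable_coe]
  exact h1

lemma coe_mean (p : PMF ℕ) : (mean p : ℝ) = ∑' j : ℕ, (j : ℝ) * (p j).toReal := by
  rw [mean, NNReal.coe_tsum]
  rfl

lemma emean_eq (h1 : Summable fun j : ℕ => (j : ℝ) * (p j).toReal) : emean p = mean p := by
  rw [mean, ENNReal.coe_tsum (summable_mul_toNNReal h1), emean]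
  refine tsum_congr fun j => ?_
  rw [ENNReal.coe_mul, ENNReal.coe_toNNReal (p.apply_ne_top j), ENNReal.coe_natCast]

/-- With no mass at `0`, a nontrivial support has an atom above `1`, which makes the comparison with
the total mass strict. -/
lemma one_lt_mean (hp0 : p 0 = 0) (hp : p.support.Nontrivial)
    (h1 : Summable fun j : ℕ => (j : ℝ) * (p j).toReal) : 1 < mean p := by
  rw [← NNReal.coe_lt_coe, coe_mean, NNReal.coe_one, ← (hasSum_toReal p).tsum_eq]
  obtain ⟨j, hj, hj1⟩ := hp.exists_ne 1
  rw [PMF.mem_support_iff] at hj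
  have hj0 : j ≠ 0 := by
    rintro rfl
    exact hj hp0
  refine Summable.tsum_lt_tsum (i := j) (fun i => ?_) ?_ (hasSum_toReal p).summable h1
  · rcases Nat.eq_zero_or_pos i with rfl | hi
    · simp [hp0]
    · have : (1 : ℝ) ≤ i := by exact_mod_cast hi
      exact le_mul_of_one_le_left ENNReal.toReal_nonneg this
  · have h2 : (1 : ℝ) < j := by
      have : 1 < j := by omega
      exact_mod_cast this
    have h3 : 0 < (p j).toReal := ENNReal.toReal_pos hj (p.apply_ne_top j)
    exact lt_mul_of_one_lt_left h3 h2

/-- The generating function near one: `1 - f (1 - u)`. -/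
noncomputable def defect (p : PMF ℕ) (u : ℝ) : ℝ := ∑' j : ℕ, (p j).toReal * (1 - (1 - u) ^ j)

/-- The relative error of the linear approximation to `defect`. -/
noncomputable def errorBound (p : PMF ℕ) (u : ℝ) : ℝ :=
  (mean p : ℝ)⁻¹ * ∑' j : ℕ, (j : ℝ) * (p j).toReal * min 1 (j * u)

lemma summable_defect {u : ℝ} (h0 : 0 ≤ u) (h1 : u ≤ 1) :
    Summable fun j : ℕ => (p j).toReal * (1 - (1 - u) ^ j) := by
  refine Summable.of_nonneg_of_le (fun j => ?_) (fun j => ?_) (hasSum_toReal p).summable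
  · have : (1 - u) ^ j ≤ 1 := pow_le_one₀ (by linarith) (by linarith)
    exact mul_nonneg ENNReal.toReal_nonneg (by linarith)
  · have : 0 ≤ (1 - u) ^ j := pow_nonneg (by linarith) _
    exact mul_le_of_le_one_right ENNReal.toReal_nonneg (by linarith)

lemma defect_nonneg {u : ℝ} (h0 : 0 ≤ u) (h1 : u ≤ 1) : 0 ≤ defect p u := by
  refine tsum_nonneg fun j => ?_
  have : (1 - u) ^ j ≤ 1 := pow_le_one₀ (by linarith) (by linarith)
  exact mul_nonneg ENNReal.toReal_nonneg (by linarith)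

lemma genFun_eq {u : ℝ} (h0 : 0 ≤ u) (h1 : u ≤ 1) :
    genFun p (ENNReal.ofReal (1 - u)) = ENNReal.ofReal (1 - defect p u) := by
  have hs : Summable fun j : ℕ => (p j).toReal * (1 - u) ^ j := by
    have := (hasSum_toReal p).summable.sub (summable_defect (p := p) h0 h1)
    refine this.congr fun j => ?_
    ring
  have h2 : 1 - defect p u = ∑' j : ℕ, (p j).toReal * (1 - u) ^ j := by
    nth_rewrite 1 [← (hasSum_toReal p).tsum_eq]
    rw [defect, ← (hasSum_toReal p).summable.tsum_sub (summable_defect h0 h1)]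
    exact tsum_congr fun j => by ring
  have h3 : ∀ j, 0 ≤ (p j).toReal * (1 - u) ^ j := fun j =>
    mul_nonneg ENNReal.toReal_nonneg (pow_nonneg (by linarith) _)
  rw [h2, ENNReal.ofReal_tsum_of_nonneg h3 hs, genFun]
  refine tsum_congr fun j => ?_
  rw [ENNReal.ofReal_mul ENNReal.toReal_nonneg, ENNReal.ofReal_toReal (p.apply_ne_top j),
    ENNReal.ofReal_pow (by linarith)]

/-- Bernoulli's inequality, averaged over `p`. -/
lemma defect_le (h : Summable fun j : ℕ => (j : ℝ) * (p j).toReal) {u : ℝ} (h0 : 0 ≤ u)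
    (h1 : u ≤ 1) : defect p u ≤ mean p * u := by
  rw [coe_mean, ← tsum_mul_right, defect]
  refine (summable_defect h0 h1).tsum_le_tsum (fun j => ?_) (h.mul_right u)
  have := one_add_mul_le_pow (a := -u) (by linarith) j
  have h2 : 1 - (1 - u) ^ j ≤ j * u := by
    rw [← sub_eq_add_neg] at this
    linarith
  calc _ ≤ (p j).toReal * (j * u) := by gcongr
    _ = _ := by ring

/-- Follows from $(1-x+x^2)(1+x)=1+x^3\ge1$ and $1+x\le e^x$. -/
lemma exp_neg_le {x : ℝ} (hx : 0 ≤ x) : Real.exp (-x) ≤ 1 - x + x ^ 2 := by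
  rw [Real.exp_neg]
  have h1 : x + 1 ≤ Real.exp x := Real.add_one_le_exp x
  rw [inv_le_iff_one_le_mul₀ (Real.exp_pos x)]
  have h2 : 0 ≤ 1 - x + x ^ 2 := by nlinarith [sq_nonneg (x - 1)]
  calc (1 : ℝ) ≤ (1 - x + x ^ 2) * (x + 1) := by nlinarith [pow_nonneg hx 3]
    _ ≤ _ := by gcongr

/-- If $ju\ge1$ the left side vanishes; otherwise $(1-u)^j\le e^{-ju}\le1-ju+(ju)^2$. -/
lemma pow_one_sub_le {u : ℝ} (h0 : 0 ≤ u) (h1 : u ≤ 1) (j : ℕ) :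
    j * u * (1 - min 1 (j * u)) ≤ 1 - (1 - u) ^ j := by
  have h2 : (1 - u) ^ j ≤ 1 := pow_le_one₀ (by linarith) (by linarith)
  rcases le_total 1 (j * u) with h | h
  · rw [min_eq_left h]
    linarith
  · rw [min_eq_right h]
    have h3 : (1 - u) ^ j ≤ Real.exp (-(j * u)) := by
      have : 1 - u ≤ Real.exp (-u) := by linarith [Real.add_one_le_exp (-u)]
      calc (1 - u) ^ j ≤ Real.exp (-u) ^ j := by gcongr
        _ = _ := by rw [← Real.exp_nat_mul]; ring_nf
    have h4 := exp_neg_le (x := j * u) (by positivity)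
    nlinarith

lemma summable_errorBound (h : Summable fun j : ℕ => (j : ℝ) * (p j).toReal) {u : ℝ}
    (h0 : 0 ≤ u) : Summable fun j : ℕ => (j : ℝ) * (p j).toReal * min 1 (j * u) := by
  refine Summable.of_nonneg_of_le (fun j => ?_) (fun j => ?_) h
  · have : 0 ≤ min 1 (j * u) := le_min zero_le_one (by positivity)
    positivity
  · exact mul_le_of_le_one_right (by positivity) (min_le_left _ _)

lemma le_defect (h : Summable fun j : ℕ => (j : ℝ) * (p j).toReal) (hm : 0 < mean p) {u : ℝ}
    (h0 : 0 ≤ u) (h1 : u ≤ 1) : mean p * u * (1 - errorBound p u) ≤ defect p u := by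
  have hm' : (mean p : ℝ) ≠ 0 := by exact_mod_cast hm.ne'
  have h2 : mean p * u * (1 - errorBound p u)
      = ∑' j : ℕ, (((j : ℝ) * (p j).toReal) * u
        - ((j : ℝ) * (p j).toReal * min 1 (j * u)) * u) := by
    rw [(h.mul_right u).tsum_sub ((summable_errorBound h h0).mul_right u), tsum_mul_right,
      tsum_mul_right, ← coe_mean, errorBound]
    field_simp
  rw [h2, defect]
  refine Summable.tsum_le_tsum (fun j => ?_)
    ((h.mul_right u).sub ((summable_errorBound h h0).mul_right u)) (summable_defect h0 h1)
  calc _ = (p j).toReal * (j * u * (1 - min 1 (j * u))) := by ring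
    _ ≤ _ := mul_le_mul_of_nonneg_left (pow_one_sub_le h0 h1 j) ENNReal.toReal_nonneg

lemma errorBound_nonneg {u : ℝ} (h0 : 0 ≤ u) : 0 ≤ errorBound p u := by
  refine mul_nonneg (by positivity) (tsum_nonneg fun j => ?_)
  have : 0 ≤ min 1 (j * u) := le_min zero_le_one (by positivity)
  positivity

lemma errorBound_mono (h : Summable fun j : ℕ => (j : ℝ) * (p j).toReal) {u u' : ℝ}
    (h0 : 0 ≤ u) (hu : u ≤ u') : errorBound p u ≤ errorBound p u' := by
  refine mul_le_mul_of_nonneg_left ?_ (by positivity)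
  refine (summable_errorBound h h0).tsum_le_tsum (fun j => ?_)
    (summable_errorBound h (h0.trans hu))
  gcongr

lemma errorBound_le_one (h : Summable fun j : ℕ => (j : ℝ) * (p j).toReal) (hm : 0 < mean p)
    {u : ℝ} (h0 : 0 ≤ u) : errorBound p u ≤ 1 := by
  have hm' : (0 : ℝ) < mean p := by exact_mod_cast hm
  rw [errorBound, inv_mul_le_iff₀ hm', mul_one, coe_mean]
  exact (summable_errorBound h h0).tsum_le_tsum
    (fun j => mul_le_of_le_one_right (by positivity) (min_le_left _ _)) h

/-- The source of the logarithm: about $\log j/\log m$ terms pass before $m^n\ge j$, each at most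
one, and from there on a geometric series dominates. -/
lemma sum_min_le {m : ℝ} (hm : 1 < m) (j N : ℕ) :
    ∑ n ∈ Finset.range N, min 1 (j * (m ^ n)⁻¹)
      ≤ Real.log j / Real.log m + 1 + (1 - m⁻¹)⁻¹ := by
  have hm0 : 0 < m := by linarith
  have hl : 0 < Real.log m := Real.log_pos hm
  set K := ⌈Real.log j / Real.log m⌉₊ with hK
  have hx : 0 ≤ Real.log j / Real.log m := div_nonneg (Real.log_natCast_nonneg j) hl.le
  have hK1 : (K : ℝ) ≤ Real.log j / Real.log m + 1 := (Nat.ceil_lt_add_one hx).le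
  have hK2 : (j : ℝ) ≤ m ^ K := by
    rcases Nat.eq_zero_or_pos j with rfl | hj
    · simp; positivity
    · have hj' : (0 : ℝ) < j := by exact_mod_cast hj
      rw [← Real.log_le_log_iff hj' (by positivity), Real.log_pow, ← div_le_iff₀ hl]
      exact Nat.le_ceil _
  have hpos : ∀ n, 0 ≤ min 1 ((j : ℝ) * (m ^ n)⁻¹) := fun n => le_min zero_le_one (by positivity)
  have hgeo := hasSum_geometric_of_lt_one (r := m⁻¹) (by positivity) (inv_lt_one_of_one_lt₀ hm)
  calc ∑ n ∈ Finset.range N, min 1 (j * (m ^ n)⁻¹)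
      ≤ ∑ n ∈ Finset.range (K + N), min 1 (j * (m ^ n)⁻¹) :=
        Finset.sum_le_sum_of_subset_of_nonneg (Finset.range_mono (by omega)) fun n _ _ => hpos n
    _ = ∑ n ∈ Finset.range K, min 1 (j * (m ^ n)⁻¹)
        + ∑ n ∈ Finset.range N, min 1 (j * (m ^ (K + n))⁻¹) := Finset.sum_range_add _ _ _
    _ ≤ ∑ n ∈ Finset.range K, 1 + ∑ n ∈ Finset.range N, m⁻¹ ^ n := by
        gcongr with n _ n _
        · exact min_le_left _ _
        · refine (min_le_right _ _).trans ?_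
          rw [pow_add, mul_inv, ← mul_assoc, inv_pow]
          refine mul_le_of_le_one_left (by positivity) ?_
          rw [mul_inv_le_iff₀ (by positivity), one_mul]
          exact hK2
    _ ≤ _ := by
        gcongr
        · simpa using hK1
        · rw [← hgeo.tsum_eq]
          exact hgeo.summable.sum_le_tsum _ fun n _ => by positivity

/-- Exchanging the sums over `n` and `j` leaves $\sum_j jp_j(\log j/\log m+C)$, which is finite
exactly by the $L\log L$ hypothesis. -/
lemma summable_errorBound_pow (hlog : Summable fun j : ℕ => (j : ℝ) * Real.log j * (p j).toReal)
    (hm : 1 < mean p) : Summable fun n : ℕ => errorBound p ((mean p : ℝ) ^ n)⁻¹ := by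
  have h := summable_mul_toReal hlog
  set m : ℝ := (mean p : ℝ) with hmdef
  have hm1 : 1 < m := by exact_mod_cast hm
  have hm0 : 0 < m := by linarith
  set C := 1 + (1 - m⁻¹)⁻¹ with hC
  have hs : Summable fun j : ℕ => (j : ℝ) * (p j).toReal * (Real.log j / Real.log m + C) := by
    have := (hlog.div_const (Real.log m)).add (h.mul_right C)
    refine this.congr fun j => ?_
    ring
  refine summable_of_sum_range_le (c := m⁻¹ * ∑' j : ℕ, (j : ℝ) * (p j).toReal *
    (Real.log j / Real.log m + C)) (fun n => errorBound_nonneg (by positivity)) fun N => ?_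
  simp only [errorBound]
  rw [← Finset.mul_sum, ← Summable.tsum_finsetSum fun n _ => summable_errorBound h (by positivity)]
  refine mul_le_mul_of_nonneg_left ?_ (by positivity)
  refine Summable.tsum_le_tsum (fun j => ?_)
    (summable_sum fun n _ => summable_errorBound h (by positivity)) hs
  rw [← Finset.mul_sum]
  refine mul_le_mul_of_nonneg_left ?_ (by positivity)
  have := sum_min_le hm1 j N
  rw [hC, ← add_assoc]
  exact this

/-- Each application multiplies by the mean up to a relative error. The bound on `x` keeps the
arguments below $m^{-(r+N)},\dots,m^{-(r+1)}$ in turn, and the errors accumulate at most additively.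
-/
lemma iterate_defect (h : Summable fun j : ℕ => (j : ℝ) * (p j).toReal) (hm : 1 < mean p)
    (N : ℕ) : ∀ (r : ℕ) (x : ℝ), 0 ≤ x → x ≤ ((mean p : ℝ) ^ (r + N))⁻¹ →
      0 ≤ (defect p)^[N] x ∧ (defect p)^[N] x ≤ mean p ^ N * x ∧
      mean p ^ N * x * (1 - ∑ i ∈ Finset.range N, errorBound p ((mean p : ℝ) ^ (r + 1 + i))⁻¹)
        ≤ (defect p)^[N] x := by
  set m : ℝ := (mean p : ℝ) with hmdef
  have hm1 : 1 < m := by exact_mod_cast hm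
  have hm0 : 0 < m := by linarith
  have hmp : 0 < mean p := lt_trans one_pos hm
  induction N with
  | zero => intro r x h0 _; simp [h0]
  | succ N ih =>
    intro r x h0 hx
    obtain ⟨i1, i2, i3⟩ := ih (r + 1) x h0 (by rwa [add_right_comm])
    have hmx : m ^ N * x ≤ (m ^ (r + 1))⁻¹ := by
      calc m ^ N * x ≤ m ^ N * (m ^ (r + (N + 1)))⁻¹ := by gcongr
        _ = _ := by
          rw [show r + (N + 1) = (r + 1) + N by ring, pow_add m (r + 1) N, mul_inv]
          field_simp
    have hle1 : (m ^ (r + 1))⁻¹ ≤ 1 := inv_le_one_of_one_le₀ (one_le_pow₀ hm1.le)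
    set u := (defect p)^[N] x with hu
    have hu1 : u ≤ 1 := i2.trans (hmx.trans hle1)
    rw [Function.iterate_succ_apply', ← hu]
    refine ⟨defect_nonneg i1 hu1, (defect_le h i1 hu1).trans ?_, le_trans ?_
      (le_defect h hmp i1 hu1)⟩
    · rw [pow_succ', mul_assoc]
      gcongr
    · have hb : errorBound p u ≤ errorBound p (m ^ (r + 1))⁻¹ := errorBound_mono h i1 (i2.trans hmx)
      set b := errorBound p (m ^ (r + 1))⁻¹ with hbdef
      have hb1 : b ≤ 1 := errorBound_le_one h hmp (by positivity)
      have hb0 : 0 ≤ b := errorBound_nonneg (by positivity)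
      have hsum : ∑ i ∈ Finset.range (N + 1), errorBound p (m ^ (r + 1 + i))⁻¹
          = ∑ i ∈ Finset.range N, errorBound p (m ^ (r + 1 + 1 + i))⁻¹ + b := by
        rw [Finset.sum_range_succ']
        congr 1
        exact Finset.sum_congr rfl fun i _ => by rw [add_assoc (r + 1) 1 i, add_comm 1 i]
      rw [hsum]
      set S := ∑ i ∈ Finset.range N, errorBound p (m ^ (r + 1 + 1 + i))⁻¹ with hS
      have hS0 : 0 ≤ S := Finset.sum_nonneg fun i _ => errorBound_nonneg (by positivity)
      -- Here $(1-S)(1-b)\ge1-S-b$ since $Sb\ge0$.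
      calc m ^ (N + 1) * x * (1 - (S + b)) ≤ m ^ (N + 1) * x * ((1 - S) * (1 - b)) := by
            gcongr
            nlinarith [mul_nonneg hS0 hb0]
        _ = m * (m ^ N * x * (1 - S)) * (1 - b) := by ring
        _ ≤ m * u * (1 - b) := by
            have : 0 ≤ 1 - b := by linarith
            gcongr
        _ ≤ m * u * (1 - errorBound p u) := by gcongr

/-- A bound on the Laplace transform of the normalized number of descendants. -/
lemma iterate_genFun_le (hlog : Summable fun j : ℕ => (j : ℝ) * Real.log j * (p j).toReal)
    (hm : 1 < mean p) (r N : ℕ)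
    (hT : ∑' i, errorBound p ((mean p : ℝ) ^ (i + (r + 1)))⁻¹ ≤ 1) :
    (genFun p)^[N] (ENNReal.ofReal (Real.exp (-(((mean p : ℝ) ^ r)⁻¹ / (mean p : ℝ) ^ N)))) ≤
      ENNReal.ofReal (1 - ((mean p : ℝ) ^ r)⁻¹ * (1 - ((mean p : ℝ) ^ r)⁻¹) *
        (1 - ∑' i, errorBound p ((mean p : ℝ) ^ (i + (r + 1)))⁻¹)) := by
  have h := summable_mul_toReal hlog
  have hb := (summable_nat_add_iff (r + 1)).2 (summable_errorBound_pow hlog hm)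
  set m : ℝ := (mean p : ℝ) with hmdef
  have hm1 : 1 < m := by exact_mod_cast hm
  have hm0 : 0 < m := by linarith
  set s := (m ^ r)⁻¹ with hs
  have hs0 : 0 < s := by positivity
  have hs1 : s ≤ 1 := inv_le_one_of_one_le₀ (one_le_pow₀ hm1.le)
  set T := ∑' i, errorBound p (m ^ (i + (r + 1)))⁻¹ with hTdef
  set y := s / m ^ N with hy
  have hy0 : 0 ≤ y := by positivity
  have hys : y ≤ s := div_le_self hs0.le (one_le_pow₀ hm1.le)
  set x := 1 - Real.exp (-y) with hx
  have hx0 : 0 ≤ x := by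
    have : Real.exp (-y) ≤ 1 := Real.exp_le_one_iff.2 (by linarith)
    linarith
  have hxy : x ≤ y := by linarith [Real.add_one_le_exp (-y)]
  have hyx : y * (1 - y) ≤ x := by nlinarith [exp_neg_le hy0]
  have hyeq : y = (m ^ (r + N))⁻¹ := by
    rw [hy, hs, pow_add, mul_inv, div_eq_mul_inv]
  -- The substitution $u\mapsto1-u$ conjugates `genFun` to `defect` as long as the iterates stay in
  -- $[0,1]$, which the choice $y=m^{-(r+N)}$ ensures.
  have key : ∀ n ≤ N, (genFun p)^[n] (ENNReal.ofReal (1 - x))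
      = ENNReal.ofReal (1 - (defect p)^[n] x) := by
    intro n
    induction n with
    | zero => intro _; rfl
    | succ n ih =>
      intro hn
      have hx' : x ≤ (m ^ (r + n))⁻¹ := by
        refine (hxy.trans hyeq.le).trans ?_
        gcongr
        · exact hm1.le
        · omega
      obtain ⟨i1, i2, -⟩ := iterate_defect h hm n r x hx0 hx'
      have hle : m ^ n * x ≤ 1 := by
        calc m ^ n * x ≤ m ^ n * (m ^ (r + n))⁻¹ := by gcongr
          _ = s := by rw [pow_add, mul_inv, hs]; field_simp
          _ ≤ 1 := hs1
      rw [Function.iterate_succ_apply', Function.iterate_succ_apply', ih (by omega),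
        genFun_eq i1 (i2.trans hle)]
  have hexp : Real.exp (-y) = 1 - x := by rw [hx]; ring
  rw [hexp, key N le_rfl]
  apply ENNReal.ofReal_le_ofReal
  obtain ⟨-, -, i3⟩ := iterate_defect h hm N r x hx0 (hxy.trans hyeq.le)
  have hST : ∑ i ∈ Finset.range N, errorBound p (m ^ (r + 1 + i))⁻¹ ≤ T := by
    have := hb.sum_le_tsum (Finset.range N) fun i _ => errorBound_nonneg (by positivity)
    refine le_trans (le_of_eq (Finset.sum_congr rfl fun i _ => ?_)) this
    rw [add_comm (r + 1) i]
  have hmain : s * (1 - s) * (1 - T) ≤ (defect p)^[N] x := by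
    refine le_trans ?_ i3
    have h1 : s * (1 - s) ≤ m ^ N * x := by
      calc s * (1 - s) ≤ s * (1 - y) := by gcongr
        _ = m ^ N * (y * (1 - y)) := by rw [hy]; field_simp
        _ ≤ _ := by gcongr
    have h2 : 0 ≤ 1 - T := by linarith
    have h3 : 0 ≤ m ^ N * x := by positivity
    calc s * (1 - s) * (1 - T) ≤ m ^ N * x * (1 - T) := by gcongr
      _ ≤ _ := by gcongr
  linarith

end GaltonWatson

/-! ### Kesten–Stigum theorem and the expectation at the root -/

namespace GaltonWatson

variable {p : PMF ℕ} {q : List ℕ → PMF ℕ}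

/-- The lower limit of `a n / m ^ n`. -/
noncomputable def normalizedLimit (m : ℝ≥0) (a : ℕ → ℕ) : ℝ≥0∞ :=
  liminf (fun n => (a n : ℝ≥0∞) / (m : ℝ≥0∞) ^ n) atTop

lemma tendsto_ennreal_of_tendsto {m : ℝ≥0} (hm : 0 < m) {a : ℕ → ℕ} {w : ℝ}
    (h : Tendsto (fun n => (a n : ℝ) / (m : ℝ) ^ n) atTop (𝓝 w)) :
    Tendsto (fun n => (a n : ℝ≥0∞) / (m : ℝ≥0∞) ^ n) atTop (𝓝 (ENNReal.ofReal w)) := by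
  have hmr : (0 : ℝ) < m := by exact_mod_cast hm
  refine ((ENNReal.continuous_ofReal.tendsto w).comp h).congr fun n => ?_
  simp only [Function.comp]
  rw [ENNReal.ofReal_div_of_pos (by positivity), ENNReal.ofReal_natCast,
    ENNReal.ofReal_pow hmr.le, ENNReal.ofReal_coe_nnreal]

lemma nonneg_of_tendsto {m : ℝ≥0} {a : ℕ → ℕ} {w : ℝ}
    (h : Tendsto (fun n => (a n : ℝ) / (m : ℝ) ^ n) atTop (𝓝 w)) : 0 ≤ w :=
  ge_of_tendsto' h fun n => by positivity

lemma normalizedLimit_eq {m : ℝ≥0} (hm : 0 < m) {a : ℕ → ℕ} {w : ℝ}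
    (h : Tendsto (fun n => (a n : ℝ) / (m : ℝ) ^ n) atTop (𝓝 w)) :
    normalizedLimit m a = ENNReal.ofReal w :=
  (tendsto_ennreal_of_tendsto hm h).liminf_eq

lemma measurable_normalizedLimit {Ω : Type*} {mΩ : MeasurableSpace Ω} (m : ℝ≥0)
    {a : ℕ → Ω → ℕ} (ha : ∀ n, Measurable (a n)) :
    Measurable fun ω => normalizedLimit m fun n => a n ω :=
  Measurable.liminf fun n =>
    (measurable_of_countable fun j : ℕ => (j : ℝ≥0∞) / (m : ℝ≥0∞) ^ n).comp (ha n)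

lemma lintegral_normalizedLimit_le (hq : ∀ v, v ≠ [] → q v = p) {m : ℝ≥0} (hm0 : 0 < m)
    (hm : emean p = m) {v : List ℕ} (hv : v ≠ []) :
    ∫⁻ k, normalizedLimit m (fun n => population k n v) ∂offspringLaw q ≤ 1 := by
  have hme : (m : ℝ≥0∞) ≠ 0 := by exact_mod_cast hm0.ne'
  refine (lintegral_liminf_le fun n =>
    (measurable_of_countable fun j : ℕ => (j : ℝ≥0∞) / (m : ℝ≥0∞) ^ n).comp
      (measurable_population' n v)).trans ?_
  have : ∀ n, ∫⁻ k, (population k n v : ℝ≥0∞) / (m : ℝ≥0∞) ^ n ∂offspringLaw q = 1 := by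
    intro n
    simp only [div_eq_mul_inv]
    have h : Measurable fun k => (population k n v : ℝ≥0∞) :=
      (measurable_of_countable fun j : ℕ => (j : ℝ≥0∞)).comp (measurable_population' n v)
    rw [lintegral_mul_const _ h,
      lintegral_population hq n hv, hm, ENNReal.mul_inv_cancel (pow_ne_zero _ hme) (by finiteness)]
  simp [this]

/-- Integrates $1\le e^{-sW}+sW$ at $s=m^{-r}$; Fatou transfers to $W$ the bound on the Laplace
transforms, which is uniform in the generation. -/
lemma one_le_lintegral_add (hq : ∀ v, v ≠ [] → q v = p)
    (hlog : Summable fun j : ℕ => (j : ℝ) * Real.log j * (p j).toReal) (hm : 1 < mean p)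
    {v : List ℕ} (hv : v ≠ []) (r : ℕ)
    (hT : ∑' i, errorBound p ((mean p : ℝ) ^ (i + (r + 1)))⁻¹ ≤ 1) :
    1 ≤ ENNReal.ofReal (1 - ((mean p : ℝ) ^ r)⁻¹ * (1 - ((mean p : ℝ) ^ r)⁻¹) *
        (1 - ∑' i, errorBound p ((mean p : ℝ) ^ (i + (r + 1)))⁻¹)) +
      ENNReal.ofReal ((mean p : ℝ) ^ r)⁻¹ *
        ∫⁻ k, normalizedLimit (mean p) (fun n => population k n v) ∂offspringLaw q := by
  have hm0 : 0 < mean p := lt_trans one_pos hm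
  have hconv := ae_exists_tendsto_population hq hm0 (emean_eq (summable_mul_toReal hlog)) hv
  have hbound := iterate_genFun_le hlog hm r (hT := hT)
  set m : ℝ := (mean p : ℝ) with hmdef
  have hmr : 0 < m := by exact_mod_cast hm0
  set s := (m ^ r)⁻¹ with hs
  have hs0 : 0 ≤ s := by positivity
  set g : ℕ → (List ℕ → ℕ) → ℝ≥0∞ := fun N k =>
    ENNReal.ofReal (Real.exp (-(s / m ^ N))) ^ population k N v with hg
  have hgm : ∀ N, Measurable (g N) := fun N =>
    (measurable_of_countable fun j : ℕ => ENNReal.ofReal (Real.exp (-(s / m ^ N))) ^ j).comp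
      (measurable_population' N v)
  have hfatou : ∫⁻ k, liminf (fun N => g N k) atTop ∂offspringLaw q ≤ ENNReal.ofReal (1 - s *
      (1 - s) * (1 - ∑' i, errorBound p (m ^ (i + (r + 1)))⁻¹)) := by
    refine (lintegral_liminf_le hgm).trans ?_
    refine liminf_le_of_le (by isBoundedDefault) fun b hb => ?_
    obtain ⟨N, hN⟩ := hb.exists
    refine hN.trans ?_
    rw [hg, lintegral_pow_population hq _ N v hv]
    exact hbound N
  have hpt : ∀ᵐ k ∂offspringLaw q, 1 ≤ liminf (fun N => g N k) atTop +
      ENNReal.ofReal s * normalizedLimit (mean p) (fun n => population k n v) := by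
    filter_upwards [hconv] with k hk
    obtain ⟨w, hw⟩ := hk
    have hlim : Tendsto (fun N => g N k) atTop (𝓝 (ENNReal.ofReal (Real.exp (-(s * w))))) := by
      have h1 : Tendsto (fun N => Real.exp (-(s * ((population k N v : ℝ) / m ^ N)))) atTop
          (𝓝 (Real.exp (-(s * w)))) :=
        (Real.continuous_exp.tendsto _).comp (hw.const_mul s).neg
      refine ((ENNReal.continuous_ofReal.tendsto _).comp h1).congr fun N => ?_
      simp only [Function.comp, hg]
      rw [← ENNReal.ofReal_pow (Real.exp_pos _).le, ← Real.exp_nat_mul]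
      congr 2
      ring
    have hw0 := nonneg_of_tendsto hw
    rw [hlim.liminf_eq, normalizedLimit_eq hm0 hw, ← ENNReal.ofReal_mul hs0,
      ← ENNReal.ofReal_add (Real.exp_pos _).le (by positivity), ENNReal.one_le_ofReal]
    linarith [Real.add_one_le_exp (-(s * w))]
  calc (1 : ℝ≥0∞) = ∫⁻ _, 1 ∂offspringLaw q := by simp
    _ ≤ ∫⁻ k, (liminf (fun N => g N k) atTop +
      ENNReal.ofReal s * normalizedLimit (mean p) (fun n => population k n v)) ∂offspringLaw q :=
        lintegral_mono_ae hpt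
    _ = ∫⁻ k, liminf (fun N => g N k) atTop ∂offspringLaw q + ENNReal.ofReal s *
        ∫⁻ k, normalizedLimit (mean p) (fun n => population k n v) ∂offspringLaw q := by
      rw [lintegral_add_left (Measurable.liminf hgm), lintegral_const_mul]
      exact measurable_normalizedLimit _ fun n => measurable_population' n v
    _ ≤ _ := by gcongr

/-- **Kesten–Stigum theorem**: under the `L log L` condition the limit of the normalized numbers
of descendants has expectation one. -/
theorem lintegral_normalizedLimit (hq : ∀ v, v ≠ [] → q v = p)
    (hlog : Summable fun j : ℕ => (j : ℝ) * Real.log j * (p j).toReal) (hm : 1 < mean p)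
    {v : List ℕ} (hv : v ≠ []) :
    ∫⁻ k, normalizedLimit (mean p) (fun n => population k n v) ∂offspringLaw q = 1 := by
  have hm0 : 0 < mean p := lt_trans one_pos hm
  have hle := lintegral_normalizedLimit_le hq hm0 (emean_eq (summable_mul_toReal hlog)) hv
  have hadd := one_le_lintegral_add hq hlog hm hv
  refine le_antisymm hle ?_
  set I := ∫⁻ k, normalizedLimit (mean p) (fun n => population k n v) ∂offspringLaw q
  have hItop : I ≠ ∞ := ne_top_of_le_ne_top ENNReal.one_ne_top hle
  set m : ℝ := (mean p : ℝ) with hmdef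
  have hm1 : 1 < m := by exact_mod_cast hm
  have hmr : 0 < m := by linarith
  have hT : Tendsto (fun r => ∑' i, errorBound p (m ^ (i + (r + 1)))⁻¹) atTop (𝓝 0) :=
    (tendsto_sum_nat_add fun n => errorBound p (m ^ n)⁻¹).comp (tendsto_add_atTop_nat 1)
  have hs : Tendsto (fun r : ℕ => (m ^ r)⁻¹) atTop (𝓝 0) :=
    tendsto_inv_atTop_zero.comp (tendsto_pow_atTop_atTop_of_one_lt hm1)
  have hlim : Tendsto (fun r : ℕ => (1 - (m ^ r)⁻¹) *
      (1 - ∑' i, errorBound p (m ^ (i + (r + 1)))⁻¹)) atTop (𝓝 1) := by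
    have := (hs.const_sub 1).mul (hT.const_sub 1)
    simpa using this
  -- Cancelling `1` and dividing by $s=m^{-r}$ in `hadd` leaves a lower bound for the expectation
  -- that tends to one.
  have hev : ∀ᶠ r : ℕ in atTop, (1 - (m ^ r)⁻¹) *
      (1 - ∑' i, errorBound p (m ^ (i + (r + 1)))⁻¹) ≤ I.toReal := by
    filter_upwards [hT.eventually_le_const one_pos] with r hr
    have h1 := hadd r hr
    have hT0 : 0 ≤ ∑' i, errorBound p (m ^ (i + (r + 1)))⁻¹ :=
      tsum_nonneg fun i => errorBound_nonneg (by positivity)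
    set T := ∑' i, errorBound p (m ^ (i + (r + 1)))⁻¹
    have hs0 : 0 < (m ^ r)⁻¹ := by positivity
    have hs1 : (m ^ r)⁻¹ ≤ 1 := inv_le_one_of_one_le₀ (one_le_pow₀ hm1.le)
    set s := (m ^ r)⁻¹
    have hc : 0 ≤ 1 - s * (1 - s) * (1 - T) := by
      have h2 : s * (1 - s) ≤ 1 := by nlinarith
      have h3 : 0 ≤ s * (1 - s) := mul_nonneg hs0.le (by linarith)
      nlinarith
    rw [← ENNReal.ofReal_toReal hItop, ← ENNReal.ofReal_mul hs0.le,
      ← ENNReal.ofReal_add hc (by positivity), ENNReal.one_le_ofReal] at h1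
    have h2 : s * ((1 - s) * (1 - T)) ≤ s * I.toReal := by linarith
    exact le_of_mul_le_mul_left h2 hs0
  have h1 := le_of_tendsto hlim hev
  rw [← ENNReal.ofReal_toReal hItop]
  exact ENNReal.one_le_ofReal.2 h1

/-- Generation `n + 1` of the root collects generation `n` of its children; the index shift costs
the factor $m^{-1}$. -/
lemma tendsto_population_root {m : ℝ≥0} {k : List ℕ → ℕ} {w : ℕ → ℝ}
    (h : ∀ i, Tendsto (fun n => (population k n [i] : ℝ) / (m : ℝ) ^ n) atTop (𝓝 (w i))) :
    Tendsto (fun n => (population k n [] : ℝ) / (m : ℝ) ^ n) atTop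
      (𝓝 ((∑ i ∈ Finset.range (k []), w i) * (m : ℝ)⁻¹)) := by
  rw [← tendsto_add_atTop_iff_nat 1]
  refine ((tendsto_finsetSum (Finset.range (k [])) fun i _ => h i).mul_const (m : ℝ)⁻¹).congr
    fun n => ?_
  rw [population, Nat.cast_sum, ← Finset.sum_div, pow_succ, div_mul_eq_div_div, div_eq_mul_inv _ (m : ℝ)]

lemma ae_tendsto_population (hq : ∀ v, v ≠ [] → q v = p) {m : ℝ≥0} (hm0 : 0 < m)
    (hm : emean p = m) : ∀ᵐ k ∂offspringLaw q, ∀ v, v ≠ [] → ∃ w : ℝ,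
      Tendsto (fun n => (population k n v : ℝ) / (m : ℝ) ^ n) atTop (𝓝 w) := by
  rw [ae_all_iff]
  intro v
  by_cases hv : v = []
  · simp [hv]
  · filter_upwards [ae_exists_tendsto_population hq hm0 hm hv] with k hk _ using hk

lemma ae_hasLimits (hq : ∀ v, v ≠ [] → q v = p) {m : ℝ≥0} (hm0 : 0 < m)
    (hm : emean p = m) : ∀ᵐ k ∂offspringLaw q, (tree k).HasLimits m := by
  filter_upwards [ae_tendsto_population hq hm0 hm] with k hk x
  simp only [descendantCount_tree]
  by_cases hx : label x = []
  · rw [hx]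
    choose w hw using fun i : ℕ => hk [i] (by simp)
    exact ⟨_, tendsto_population_root hw⟩
  · exact hk _ hx

/-- Wald's identity: the event `i < k []` is independent of the limit in the subtree of `[i]`, which
has mean one, so only the mean number of children of the root remains. -/
lemma lintegral_normalizedLimit_root (hq : ∀ v, v ≠ [] → q v = p)
    (hlog : Summable fun j : ℕ => (j : ℝ) * Real.log j * (p j).toReal) (hm : 1 < mean p) :
    ∫⁻ k, normalizedLimit (mean p) (fun n => population k n []) ∂offspringLaw q
      = emean (q []) * (mean p : ℝ≥0∞)⁻¹ := by
  have hm0 : 0 < mean p := lt_trans one_pos hm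
  have hmr : (0 : ℝ) < mean p := by exact_mod_cast hm0
  have hae := ae_tendsto_population hq hm0 (emean_eq (summable_mul_toReal hlog))
  have hroot : ∀ᵐ k ∂offspringLaw q, normalizedLimit (mean p) (fun n => population k n [])
      = (∑' i, (if i < k [] then 1 else 0) *
        normalizedLimit (mean p) (fun n => population k n [i])) * (mean p : ℝ≥0∞)⁻¹ := by
    filter_upwards [hae] with k hk
    choose w hw using fun i : ℕ => hk [i] (by simp)
    have hw0 : ∀ i, 0 ≤ w i := fun i => nonneg_of_tendsto (hw i)
    rw [normalizedLimit_eq hm0 (tendsto_population_root hw),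
      ENNReal.ofReal_mul (Finset.sum_nonneg fun i _ => hw0 i),
      ENNReal.ofReal_sum_of_nonneg fun i _ => hw0 i, ENNReal.ofReal_inv_of_pos hmr,
      ENNReal.ofReal_coe_nnreal, sum_range_eq_tsum]
    congr 1
    refine tsum_congr fun i => ?_
    rw [normalizedLimit_eq hm0 (hw i), ite_mul, one_mul, zero_mul]
  have hmeas : ∀ i : ℕ, Measurable fun k : List ℕ → ℕ => if i < k [] then (1 : ℝ≥0∞) else 0 :=
    fun i => (measurable_of_countable fun j : ℕ => if i < j then (1 : ℝ≥0∞) else 0).comp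
      (measurable_pi_apply [])
  have hmeas' : ∀ i : ℕ, Measurable fun k : List ℕ → ℕ =>
      normalizedLimit (mean p) (fun n => population k n [i]) :=
    fun i => measurable_normalizedLimit _ fun n => measurable_population' n _
  have hprod : ∀ i : ℕ, ∫⁻ k, (if i < k [] then 1 else 0) *
      normalizedLimit (mean p) (fun n => population k n [i]) ∂offspringLaw q
        = ∫⁻ k, (if i < k [] then 1 else 0) ∂offspringLaw q := by
    intro i
    rw [lintegral_mul_of_disjoint q (S := {[]}) (S' := {w | [i] <:+ w}),
      lintegral_normalizedLimit hq hlog hm (by simp), mul_one]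
    · simp
    · exact (measurable_of_countable fun j : ℕ => if i < j then (1 : ℝ≥0∞) else 0).comp
        (measurable_coord rfl)
    · exact measurable_normalizedLimit _ fun n => measurable_population n _ fun w hw _ => hw
  have hmul : ∀ i : ℕ, Measurable fun k : List ℕ → ℕ => (if i < k [] then (1 : ℝ≥0∞) else 0) *
      normalizedLimit (mean p) (fun n => population k n [i]) := fun i => (hmeas i).mul (hmeas' i)
  rw [lintegral_congr_ae hroot, lintegral_mul_const _ (Measurable.tsum hmul),
    lintegral_tsum fun i => (hmul i).aemeasurable]
  congr 1
  simp only [hprod]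
  rw [← lintegral_tsum fun i => (hmeas i).aemeasurable]
  simp only [← sum_range_eq_tsum, Finset.sum_const, Finset.card_range, nsmul_eq_mul, mul_one]
  exact lintegral_coord q [] fun j => (j : ℝ≥0∞)

lemma emean_map_succ (p : PMF ℕ) : emean (p.map Nat.succ) = emean p + 1 := by
  rw [emean, ← lintegral_toMeasure, ← PMF.toMeasure_map Nat.succ p (measurable_of_countable _),
    lintegral_map (measurable_of_countable _) (measurable_of_countable _), lintegral_toMeasure,
    emean, ← p.tsum_coe, ← ENNReal.tsum_add]
  refine tsum_congr fun j => ?_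
  rw [Nat.succ_eq_add_one, Nat.cast_add, Nat.cast_one, add_mul, one_mul]

end GaltonWatson

/-! ### Passage to isomorphism classes and conclusion -/

open GaltonWatson LFRootedTree in
theorem mainTheorem5 (p : PMF ℕ) (hp0 : p 0 = 0) (hp : p.support.Nontrivial)
    (hlog : Summable fun j : ℕ => (j : ℝ) * Real.log j * (p j).toReal) :
    ∃ N : TreeSpace → ℝ,
      (∀ᵐ c ∂(GaltonWatson.augmentedMeasure p), ∀ T : LFRootedTree, T.toClass = c →
        ∃ ν : FiniteMeasure T.Compactification,
          Tendsto (fun n : ℕ => (GaltonWatson.mean p ^ n)⁻¹ • T.sphereMeasure n) atTop (𝓝 ν) ∧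
          (ν : Measure T.Compactification) (Set.range T.ofVertex) = 0 ∧
          (ν.mass : ℝ) = N c) ∧
      Integrable N (GaltonWatson.augmentedMeasure p) ∧
      ∫ c, N c ∂(GaltonWatson.augmentedMeasure p) = 1 + 1 / (GaltonWatson.mean p : ℝ) := by
  have hsum := summable_mul_toReal hlog
  have hm : 1 < mean p := one_lt_mean hp0 hp hsum
  have hm0 : 0 < mean p := lt_trans one_pos hm
  have hmr : (0 : ℝ) < mean p := by exact_mod_cast hm0
  have hme : (mean p : ℝ≥0∞) ≠ 0 := by exact_mod_cast hm0.ne'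
  set q : List ℕ → PMF ℕ := fun v => if v = [] then p.map Nat.succ else p with hqdef
  have hq : ∀ v, v ≠ [] → q v = p := fun v hv => if_neg hv
  have hlaw : augmentedOffspring p = offspringLaw q := rfl
  -- The lower limit makes this defined and measurable on every class; where the limit exists it is
  -- the mass of `ν`.
  set Ne : TreeSpace → ℝ≥0∞ := fun c => normalizedLimit (mean p) fun n => sphereCard n c with hNe
  have hNm : Measurable Ne := measurable_normalizedLimit _ measurable_sphereCard
  have hlint : ∫⁻ c, Ne c ∂augmentedMeasure p = 1 + (mean p : ℝ≥0∞)⁻¹ := by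
    rw [augmentedMeasure, lintegral_map hNm measurable_toClass_tree, hlaw]
    have : ∀ k, Ne (tree k).toClass = normalizedLimit (mean p) fun n => population k n [] := by
      intro k
      simp only [hNe, sphereCard_toClass, descendantCount_tree]
      rfl
    simp only [this]
    rw [lintegral_normalizedLimit_root hq hlog hm, hqdef]
    simp only [if_true]
    rw [emean_map_succ, emean_eq hsum, add_mul, one_mul, ENNReal.mul_inv_cancel hme (by finiteness)]
  have hfin : ∫⁻ c, Ne c ∂augmentedMeasure p ≠ ∞ := by
    rw [hlint]
    exact ENNReal.add_ne_top.2 ⟨ENNReal.one_ne_top, ENNReal.inv_ne_top.2 hme⟩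
  refine ⟨fun c => (Ne c).toReal, ?_, integrable_toReal_of_lintegral_ne_top hNm.aemeasurable hfin,
    ?_⟩
  -- Convergence is tested on a chosen representative, for which measurability is known, and carried
  -- to every `T` in the class by isomorphism invariance.
  · have hae : ∀ᵐ c : TreeSpace ∂augmentedMeasure p, HasLimits (mean p) (Quotient.out c) := by
      rw [augmentedMeasure, ae_map_iff measurable_toClass_tree.aemeasurable
        (measurableSet_hasLimits _), hlaw]
      filter_upwards [ae_hasLimits hq hm0 (emean_eq hsum)] with k hk
      exact hk.of_iso (toClass_eq_iff.1 (toClass_out _).symm)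
    filter_upwards [hae] with c hc
    rintro T rfl
    obtain ⟨ν, h1, h2, h3⟩ := T.exists_tendsto_sphereMeasure hm
      (hc.of_iso (toClass_eq_iff.1 (toClass_out _)))
    refine ⟨ν, h1, h2, ?_⟩
    simp only [hNe, sphereCard_toClass]
    rw [normalizedLimit_eq hm0 h3, ENNReal.toReal_ofReal ν.mass.coe_nonneg]
  · rw [integral_toReal hNm.aemeasurable (ae_lt_top hNm hfin), hlint,
      ENNReal.toReal_add ENNReal.one_ne_top (ENNReal.inv_ne_top.2 hme), ENNReal.toReal_inv]
    simp
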